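/- Let $K=\mathbb{C}\{x\}[x^{-1}]$ be the field of convergent Laurent series, and let $M$ be a germ of meromorphic connection: a finite-dimensional $K$-vector space with a connection $\nabla$, on which $x\partial_x$ acts by $\nabla_{x\partial_x}$. **The Deligne filtration.** The filtration $V^\bullet M$ is the decreasing, exhaustive filtration of $M$, indexed by $b\in\mathbb{R}$ and left-continuous ($V^bM=\bigcap_{c<b}V^cM$), such that each $V^bM$ is a finitely generated $\mathbb{C}\{x\}\langle x\partial_x\rangle$-submodule, $xV^bM=V^{b+1}M$, and each $\mathrm{gr}^b_VM=V^bM/\bigcup_{c>b}V^cM$ is a finite-dimensional $\mathbb{C}$-vector space on which all eigenvalues of $x\partial_x$ have real part $b$. **The parabolic filtration.** Let $q\geq1$, let $\pi:y\mapsto x=y^q$, let $N=\pi^+M=\mathbb{C}\{y\}[y^{-1}]\otimes_KM$ be the pulled-back connection, and let $\widehat N=\mathbb{C}((y))\otimes_{\mathbb{C}\{y\}[y^{-1}]}N$. Suppose that there is an isomorphism of connections $\widehat N\simeq\bigoplus_{\varphi\in\Phi}(E^\varphi\otimes R_\varphi)$ over $\mathbb{C}((y))$, where $\Phi\subset y^{-1}\mathbb{C}[y^{-1}]$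 is finite, $E^\varphi$ is the rank-one connection with a generator $e^\varphi$ such that $\nabla e^\varphi=d\varphi\otimes e^\varphi$, and each $R_\varphi$ is a formal connection with regular singularity. Let $V^bR_\varphi$ be the unique $\mathbb{C}[[y]]$-lattice of $R_\varphi$ that is stable under $y\partial_y$ and such that the eigenvalues of $y\partial_y$ on $V^bR_\varphi/yV^bR_\varphi$ have real part in $[b,b+1)$. Put $$\mathcal P^b(\widehat N)=\bigoplus_{\varphi\in\Phi}E^\varphi\otimes V^bR_\varphi,\qquad \mathcal P^b(N)=\mathcal P^b(\widehat N)\cap N,\qquad \mathcal P^b(M)=\mathcal P^{qb}(N)^{\mathbb{Z}/q\mathbb{Z}},$$ where the $q$-th roots of unity $\zeta$ act on $N$ by $g(y)\otimes m\mapsto g(\zeta y)\otimes m$, and $M$ is identified with the invariants of $N$ through $m\mapsto1\otimes m$. **Statement.** The filtration $V^\bullet M$ exists and is unique, and for every $b\in\mathbb{R}$ the $\mathbb{C}\{x\}\langle x\partial_x\rangle$-submodule of $M$ generated by $\mathcal P^b(M)$ is $V^b(M)$: $$\mathbb{C}\{x\}\langle x\partial_x\rangle\cdot\mathcal P^b(M)=V^b(M).$$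 -/

import Mathlib

open scoped LaurentSeries PowerSeries TensorProduct

/- `ℂ((x))` carries two `ℂ`-algebra structures in the library, with provably but not definitionally
equal scalar actions; only the coefficientwise one is kept. -/
attribute [-instance] HahnSeries.powerSeriesAlgebra

noncomputable section

namespace MeroConn

/-! ### Convergent Laurent series -/

/-- A formal Laurent series converges on some punctured disc around `0`: its coefficients grow at
most geometrically (there are only finitely many coefficients of negative index). -/
def IsConvergent (f : ℂ⸨X⸩) : Prop :=
  ∃ C A : ℝ, ∀ n : ℕ, ‖f.coeff (n : ℤ)‖ ≤ C * A ^ n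

theorem IsConvergent.shift {f : ℂ⸨X⸩} (hf : IsConvergent f) (N : ℤ) :
    ∃ C A : ℝ, 0 ≤ C ∧ 1 ≤ A ∧ ∀ n : ℕ, ‖f.coeff ((n : ℤ) + N)‖ ≤ C * A ^ n := by
  obtain ⟨C, A, h⟩ := hf
  have h' : ∀ n : ℕ, ‖f.coeff (n : ℤ)‖ ≤ |C| * (max 1 |A|) ^ n := fun n => by
    refine (h n).trans ((le_abs_self _).trans ?_)
    rw [abs_mul, abs_pow]
    gcongr
    exact le_max_right _ _
  have hA : (1 : ℝ) ≤ max 1 |A| := le_max_left _ _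
  set B := max 1 |A| with hB
  rcases le_total 0 N with hN | hN
  · obtain ⟨k, rfl⟩ := Int.eq_ofNat_of_zero_le hN
    refine ⟨|C| * B ^ k, B, by positivity, hA, fun n => ?_⟩
    have := h' (n + k)
    push_cast at this
    refine this.trans (le_of_eq ?_)
    ring
  · obtain ⟨k, rfl⟩ := Int.exists_eq_neg_ofNat hN
    have hs : 0 ≤ ∑ i ∈ Finset.range k, ‖f.coeff ((i : ℤ) + -(k : ℤ))‖ :=
      Finset.sum_nonneg fun _ _ => norm_nonneg _
    refine ⟨|C| + ∑ i ∈ Finset.range k, ‖f.coeff ((i : ℤ) + -(k : ℤ))‖, B, by positivity, hA,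
      fun n => ?_⟩
    have hBn : 1 ≤ B ^ n := one_le_pow₀ hA
    rcases lt_or_ge n k with hnk | hnk
    · have h1 := Finset.single_le_sum
        (f := fun i : ℕ => ‖f.coeff ((i : ℤ) + -(k : ℤ))‖) (fun _ _ => norm_nonneg _)
        (Finset.mem_range.2 hnk)
      nlinarith [abs_nonneg C]
    · obtain ⟨j, rfl⟩ := Nat.exists_eq_add_of_le hnk
      have h1 := h' j
      have h2 : ((k + j : ℕ) : ℤ) + -(k : ℤ) = j := by push_cast; ring
      rw [h2]
      have h3 : B ^ j ≤ B ^ (k + j) := pow_le_pow_right₀ hA (by omega)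
      have h4 := mul_le_mul_of_nonneg_left h3 (abs_nonneg C)
      nlinarith

theorem isConvergent_single_mul {f : ℂ⸨X⸩} (hf : IsConvergent f) (k : ℤ) :
    IsConvergent (HahnSeries.single k 1 * f) := by
  obtain ⟨C, A, -, -, h⟩ := hf.shift (-k)
  refine ⟨C, A, fun n => ?_⟩
  have := h n
  rwa [HahnSeries.coeff_single_mul, one_mul, sub_eq_add_neg]

theorem IsConvergent.exists_powerSeries {f : ℂ⸨X⸩} (hf : IsConvergent f) :
    ∃ C A : ℝ, 0 ≤ C ∧ 1 ≤ A ∧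
      ∀ n : ℕ, ‖PowerSeries.coeff n f.powerSeriesPart‖ ≤ C * A ^ n := by
  obtain ⟨C, A, hC, hA, h⟩ := hf.shift f.order
  refine ⟨C, A, hC, hA, fun n => ?_⟩
  rw [LaurentSeries.powerSeriesPart_coeff, add_comm]
  exact h n

theorem isConvergent_coe {p : ℂ⟦X⟧} {C A : ℝ} (h : ∀ n : ℕ, ‖PowerSeries.coeff n p‖ ≤ C * A ^ n) :
    IsConvergent (p : ℂ⸨X⸩) :=
  ⟨C, A, fun n => by rw [LaurentSeries.coeff_coe_powerSeries]; exact h n⟩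

theorem IsConvergent.mul {f g : ℂ⸨X⸩} (hf : IsConvergent f) (hg : IsConvergent g) :
    IsConvergent (f * g) := by
  obtain ⟨C, A, hC, hA, h⟩ := hf.exists_powerSeries
  obtain ⟨D, B, hD, hB, h'⟩ := hg.exists_powerSeries
  rw [← LaurentSeries.single_order_mul_powerSeriesPart f,
    ← LaurentSeries.single_order_mul_powerSeriesPart g, mul_mul_mul_comm, mul_assoc]
  refine isConvergent_single_mul (isConvergent_single_mul ?_ _) _
  rw [← PowerSeries.coe_mul]
  refine isConvergent_coe (C := C * D) (A := 2 * (A * B)) fun n => ?_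
  rw [PowerSeries.coeff_mul]
  have hAB : ∀ i ∈ Finset.HasAntidiagonal.antidiagonal n,
      ‖PowerSeries.coeff i.1 f.powerSeriesPart * PowerSeries.coeff i.2 g.powerSeriesPart‖
        ≤ C * D * (A * B) ^ n := by
    rintro ⟨i, j⟩ hij
    rw [Finset.HasAntidiagonal.mem_antidiagonal] at hij
    simp only at hij ⊢
    rw [norm_mul]
    have h1 : A ^ i ≤ A ^ n := pow_le_pow_right₀ hA (by omega)
    have h2 : B ^ j ≤ B ^ n := pow_le_pow_right₀ hB (by omega)
    calc _ ≤ (C * A ^ n) * (D * B ^ n) := by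
          refine mul_le_mul ((h i).trans ?_) ((h' j).trans ?_) (norm_nonneg _) (by positivity)
          · gcongr
          · gcongr
      _ = _ := by rw [mul_pow]; ring
  refine (norm_sum_le_of_le _ hAB).trans ?_
  rw [Finset.sum_const, Finset.Nat.card_antidiagonal, nsmul_eq_mul]
  have h2 : ((n + 1 : ℕ) : ℝ) ≤ 2 ^ n := by
    exact_mod_cast Nat.lt_two_pow_self
  calc _ ≤ (2 : ℝ) ^ n * (C * D * (A * B) ^ n) := by gcongr
    _ = _ := by rw [mul_pow 2]; ring

theorem IsConvergent.add {f g : ℂ⸨X⸩} (hf : IsConvergent f) (hg : IsConvergent g) :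
    IsConvergent (f + g) := by
  obtain ⟨C, A, hC, hA, h⟩ := hf.shift 0
  obtain ⟨D, B, hD, hB, h'⟩ := hg.shift 0
  refine ⟨C + D, A * B, fun n => ?_⟩
  have h1 := h n
  have h2 := h' n
  rw [add_zero] at h1 h2
  rw [HahnSeries.coeff_add, mul_pow]
  refine (norm_add_le _ _).trans ?_
  have hAn : 1 ≤ A ^ n := one_le_pow₀ hA
  have hBn : 1 ≤ B ^ n := one_le_pow₀ hB
  have e1 : A ^ n ≤ A ^ n * B ^ n := le_mul_of_one_le_right (by positivity) hBn
  have e2 : B ^ n ≤ A ^ n * B ^ n := le_mul_of_one_le_left (by positivity) hAn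
  have e3 := mul_le_mul_of_nonneg_left e1 hC
  have e4 := mul_le_mul_of_nonneg_left e2 hD
  nlinarith

theorem isConvergent_C (c : ℂ) : IsConvergent (HahnSeries.C c : ℂ⸨X⸩) := by
  refine ⟨‖c‖, 1, fun n => ?_⟩
  rw [HahnSeries.C_apply, HahnSeries.coeff_single]
  split_ifs <;> simp

theorem IsConvergent.inv {f : ℂ⸨X⸩} (hf : IsConvergent f) : IsConvergent f⁻¹ := by
  rcases eq_or_ne f 0 with rfl | hf0
  · simpa using hf
  obtain ⟨C, A, hC, hA, h⟩ := hf.exists_powerSeries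
  set p := f.powerSeriesPart with hp
  have hfp : HahnSeries.single f.order 1 * (p : ℂ⸨X⸩) = f :=
    LaurentSeries.single_order_mul_powerSeriesPart f
  have hc : PowerSeries.constantCoeff p ≠ 0 := by
    rw [← PowerSeries.coeff_zero_eq_constantCoeff_apply, hp, LaurentSeries.powerSeriesPart_coeff]
    simpa using HahnSeries.coeff_order_eq_zero.not.2 hf0
  have hinv : f⁻¹ = HahnSeries.single (-f.order) 1 * ((p⁻¹ : ℂ⟦X⟧) : ℂ⸨X⸩) := by
    refine inv_eq_of_mul_eq_one_right ?_
    calc f * _ = HahnSeries.single f.order 1 * (p : ℂ⸨X⸩) *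
          (HahnSeries.single (-f.order) 1 * ((p⁻¹ : ℂ⟦X⟧) : ℂ⸨X⸩)) := by rw [hfp]
      _ = 1 := by
        rw [mul_mul_mul_comm, ← PowerSeries.coe_mul, PowerSeries.mul_inv_cancel _ hc,
          HahnSeries.single_mul_single]
        simp
  rw [hinv]
  refine isConvergent_single_mul ?_ _
  set a := PowerSeries.constantCoeff p with ha
  have han : 0 < ‖a‖ := norm_pos_iff.2 hc
  set B : ℝ := A * max 1 (C / ‖a‖) with hB
  have hBpos : 0 < B := by positivity
  have hbd : ∀ k : ℕ, k ≠ 0 → ‖a‖⁻¹ * ‖PowerSeries.coeff k p‖ ≤ B ^ k := fun k hk => by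
    have h1 : C / ‖a‖ ≤ (max 1 (C / ‖a‖)) ^ k :=
      (le_max_right _ _).trans (le_self_pow₀ (le_max_left _ _) hk)
    calc ‖a‖⁻¹ * ‖PowerSeries.coeff k p‖ ≤ ‖a‖⁻¹ * (C * A ^ k) := by
          gcongr
          exact h k
      _ = A ^ k * (C / ‖a‖) := by ring
      _ ≤ A ^ k * (max 1 (C / ‖a‖)) ^ k := by gcongr
      _ = _ := by rw [hB, mul_pow]
  refine isConvergent_coe (C := ‖a‖⁻¹) (A := 2 * B) fun n => ?_
  induction n using Nat.strong_induction_on with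
  | _ n ih =>
    rw [PowerSeries.coeff_inv]
    split_ifs with hn
    · subst hn
      simp [← ha]
    · rw [← ha, norm_mul, norm_neg, norm_inv]
      refine mul_le_mul_of_nonneg_left ?_ (by positivity)
      have hterm : ∀ x ∈ Finset.HasAntidiagonal.antidiagonal n,
          ‖if x.2 < n then PowerSeries.coeff x.1 p * PowerSeries.coeff x.2 p⁻¹ else 0‖ ≤
            B ^ n * (if x.2 < n then (2 : ℝ) ^ x.2 else 0) := by
        rintro ⟨i, j⟩ hij
        rw [Finset.HasAntidiagonal.mem_antidiagonal] at hij
        simp only at hij ⊢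
        split_ifs with hj
        · rw [norm_mul]
          have h1 := ih j hj
          have h2 := hbd i (by omega)
          calc ‖PowerSeries.coeff i p‖ * ‖PowerSeries.coeff j p⁻¹‖
              ≤ ‖PowerSeries.coeff i p‖ * (‖a‖⁻¹ * (2 * B) ^ j) := by gcongr
            _ = (‖a‖⁻¹ * ‖PowerSeries.coeff i p‖) * (2 * B) ^ j := by ring
            _ ≤ B ^ i * (2 * B) ^ j := by gcongr
            _ = B ^ n * 2 ^ j := by rw [← hij, mul_pow, pow_add]; ring
        · simp
      refine (norm_sum_le_of_le _ hterm).trans ?_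
      rw [← Finset.mul_sum, mul_pow 2 B, mul_comm (2 ^ n)]
      have h3 : ∀ k ∈ Finset.range n, (if n - (k + 1) < n then (2 : ℝ) ^ (n - (k + 1)) else 0) =
          2 ^ (n - 1 - k) := by
        intro k hk
        rw [if_pos (by have := Finset.mem_range.1 hk; omega), Nat.sub_sub, add_comm]
      have h4 : ∑ x ∈ Finset.HasAntidiagonal.antidiagonal n,
          (if x.2 < n then (2 : ℝ) ^ x.2 else 0) ≤ 2 ^ n := by
        rw [Finset.Nat.sum_antidiagonal_eq_sum_range_succ_mk, Finset.sum_range_succ',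
          Finset.sum_congr rfl h3, Finset.sum_range_reflect (fun j => (2 : ℝ) ^ j) n,
          geom_sum_eq (by norm_num)]
        simp only [Nat.sub_zero, lt_irrefl, if_false]
        norm_num
      exact mul_le_mul_of_nonneg_left h4 (by positivity)

/-- The field `ℂ{x}[1/x]` of convergent Laurent series, as a subfield of `ℂ((x))`. -/
def ConvLaurent : IntermediateField ℂ ℂ⸨X⸩ where
  carrier := {f | IsConvergent f}
  mul_mem' := IsConvergent.mul
  add_mem' := IsConvergent.add
  algebraMap_mem' c := by
    have : algebraMap ℂ ℂ⸨X⸩ c = HahnSeries.C c := rfl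
    rw [this]
    exact isConvergent_C c
  inv_mem' _ := IsConvergent.inv

theorem mem_convLaurent {f : ℂ⸨X⸩} : f ∈ ConvLaurent ↔ IsConvergent f := Iff.rfl

/-- The ring `ℂ{x}` of convergent power series, as a subring of `ℂ{x}[1/x]`. -/
def ConvPower : Subring ConvLaurent :=
  (LaurentSeries.powerSeries_as_subring ℂ).comap (algebraMap ConvLaurent ℂ⸨X⸩)

/-- The coordinate `x`, as an element of `ℂ{x}[1/x]`. -/
def coordX : ConvLaurent :=
  ⟨HahnSeries.single 1 1, by
    rw [mem_convLaurent, ← mul_one (HahnSeries.single 1 1)]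
    exact isConvergent_single_mul (isConvergent_C 1) 1⟩

/-! ### Operations on Laurent series: `x d/dx`, rotations, ramification -/

/-- Multiplication of the coefficient `aₙ` of a Laurent series by `w n`. -/
def weightSeries (w : ℤ → ℂ) (f : ℂ⸨X⸩) : ℂ⸨X⸩ :=
  ⟨fun n => w n * f.coeff n, f.isPWO_support.mono fun n hn h => hn (by simp [h])⟩

theorem weightSeries_coeff (w : ℤ → ℂ) (f : ℂ⸨X⸩) (n : ℤ) :
    (weightSeries w f).coeff n = w n * f.coeff n := rfl

theorem support_weightSeries (w : ℤ → ℂ) (f : ℂ⸨X⸩) : (weightSeries w f).support ⊆ f.support :=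
  fun n hn h => hn (by rw [weightSeries_coeff, h, mul_zero])

theorem coeff_weightSeries_mul (w v : ℤ → ℂ) (f g : ℂ⸨X⸩) (n : ℤ) :
    (weightSeries w f * weightSeries v g).coeff n =
      ∑ ij ∈ Finset.antidiagonal f.isPWO_support g.isPWO_support n,
        w ij.1 * v ij.2 * (f.coeff ij.1 * g.coeff ij.2) := by
  rw [HahnSeries.coeff_mul]
  refine Finset.sum_congr_of_eq_on_inter ?_ ?_ ?_
  · intro ij hij hij'
    rw [Finset.mem_antidiagonal] at hij hij'
    exact absurd ⟨support_weightSeries w f hij.1, support_weightSeries v g hij.2.1, hij.2.2⟩ hij'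
  · intro ij hij hij'
    rw [Finset.mem_antidiagonal] at hij hij'
    by_contra h
    refine hij' ⟨fun h' => h ?_, fun h' => h ?_, hij.2.2⟩
    · rw [weightSeries_coeff] at h'
      linear_combination v ij.2 * g.coeff ij.2 * h'
    · rw [weightSeries_coeff] at h'
      linear_combination w ij.1 * f.coeff ij.1 * h'
  · intro ij _ _
    rw [weightSeries_coeff, weightSeries_coeff]
    ring

theorem weightSeries_one (f : ℂ⸨X⸩) : weightSeries (fun _ => 1) f = f := by
  ext n
  rw [weightSeries_coeff, one_mul]

/-- The derivation `x d/dx` of `ℂ((x))`: `∑ aₙ xⁿ ↦ ∑ n aₙ xⁿ`. -/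
def eulerFormal : Derivation ℂ ℂ⸨X⸩ ℂ⸨X⸩ where
  toFun f := weightSeries (fun n => (n : ℂ)) f
  map_add' f g := by ext n; simp [weightSeries_coeff, mul_add]
  map_smul' c f := by ext n; simp [weightSeries_coeff]; ring
  map_one_eq_zero' := by
    ext n
    simp only [LinearMap.coe_mk, AddHom.coe_mk, HahnSeries.coeff_one, HahnSeries.coeff_zero,
      weightSeries_coeff]
    split_ifs with h <;> simp [h]
  leibniz' f g := by
    ext n
    simp only [LinearMap.coe_mk, AddHom.coe_mk, smul_eq_mul, HahnSeries.coeff_add]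
    have h1 := coeff_weightSeries_mul (fun _ => 1) (fun n => (n : ℂ)) f g n
    have h2 := coeff_weightSeries_mul (fun n => (n : ℂ)) (fun _ => 1) f g n
    rw [weightSeries_one] at h1 h2
    rw [mul_comm g, h1, h2, weightSeries_coeff, HahnSeries.coeff_mul, Finset.mul_sum,
      ← Finset.sum_add_distrib]
    refine Finset.sum_congr rfl fun ij hij => ?_
    have : ij.1 + ij.2 = n := (Finset.mem_antidiagonal.1 hij).2.2
    rw [← this]
    push_cast
    ring

theorem eulerFormal_coeff (f : ℂ⸨X⸩) (n : ℤ) :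
    (eulerFormal f).coeff n = (n : ℂ) * f.coeff n := rfl

theorem IsConvergent.euler {f : ℂ⸨X⸩} (hf : IsConvergent f) : IsConvergent (eulerFormal f) := by
  obtain ⟨C, A, h⟩ := hf
  refine ⟨C, 2 * A, fun n => ?_⟩
  rw [eulerFormal_coeff, norm_mul, mul_pow]
  have h1 : ‖((n : ℤ) : ℂ)‖ ≤ 2 ^ n := by
    simp only [Int.cast_natCast, Complex.norm_natCast]
    exact_mod_cast Nat.lt_two_pow_self.le
  calc _ ≤ 2 ^ n * (C * A ^ n) := mul_le_mul h1 (h n) (norm_nonneg _) (by positivity)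
    _ = _ := by ring

/-- The derivation `x d/dx` of `ℂ{x}[1/x]`. -/
def eulerConv : Derivation ℂ ConvLaurent ConvLaurent where
  toFun f := ⟨eulerFormal f, IsConvergent.euler f.2⟩
  map_add' f g := Subtype.ext (map_add eulerFormal (f : ℂ⸨X⸩) g)
  map_smul' c f := Subtype.ext (eulerFormal.map_smul c (f : ℂ⸨X⸩))
  map_one_eq_zero' := Subtype.ext eulerFormal.map_one_eq_zero
  leibniz' f g := Subtype.ext (eulerFormal.leibniz (f : ℂ⸨X⸩) g)

/-- The rotation `f(y) ↦ f(ζ y)`, that is `∑ aₙ yⁿ ↦ ∑ ζⁿ aₙ yⁿ`, on `ℂ((y))`. -/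
def rotateFormal (ζ : ℂˣ) : ℂ⸨X⸩ →+* ℂ⸨X⸩ where
  toFun f := weightSeries (fun n => ((ζ ^ n : ℂˣ) : ℂ)) f
  map_zero' := by ext n; simp [weightSeries_coeff]
  map_one' := by
    ext n
    simp only [HahnSeries.coeff_one, weightSeries_coeff]
    split_ifs with h <;> simp [h]
  map_add' f g := by ext n; simp [weightSeries_coeff, mul_add]
  map_mul' f g := by
    ext n
    rw [coeff_weightSeries_mul, weightSeries_coeff, HahnSeries.coeff_mul, Finset.mul_sum]
    refine Finset.sum_congr rfl fun ij hij => ?_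
    have : ij.1 + ij.2 = n := (Finset.mem_antidiagonal.1 hij).2.2
    rw [← this, zpow_add, Units.val_mul]

theorem rotateFormal_coeff (ζ : ℂˣ) (f : ℂ⸨X⸩) (n : ℤ) :
    (rotateFormal ζ f).coeff n = ((ζ ^ n : ℂˣ) : ℂ) * f.coeff n := rfl

theorem IsConvergent.rotate {f : ℂ⸨X⸩} (hf : IsConvergent f) (ζ : ℂˣ) :
    IsConvergent (rotateFormal ζ f) := by
  obtain ⟨C, A, h⟩ := hf
  refine ⟨C, ‖(ζ : ℂ)‖ * A, fun n => ?_⟩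
  rw [rotateFormal_coeff, norm_mul, mul_pow, zpow_natCast, Units.val_pow_eq_pow_val, norm_pow]
  calc _ ≤ ‖(ζ : ℂ)‖ ^ n * (C * A ^ n) := by gcongr; exact h n
    _ = _ := by ring

/-- The substitution `f(x) ↦ f(y ^ q)` from `ℂ((x))` to `ℂ((y))`. -/
def ramifyFormal (q : ℕ) [NeZero q] : ℂ⸨X⸩ →+* ℂ⸨X⸩ :=
  HahnSeries.embDomainRingHom (AddMonoidHom.mulLeft (q : ℤ))
    (mul_right_injective₀ (by exact_mod_cast NeZero.ne q))
    (fun _ _ => mul_le_mul_iff_right₀ (by exact_mod_cast NeZero.pos q))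

theorem ramifyFormal_coeff_mul (q : ℕ) [NeZero q] (f : ℂ⸨X⸩) (n : ℤ) :
    (ramifyFormal q f).coeff (q * n) = f.coeff n :=
  HahnSeries.embDomain_coeff
    (f := ⟨⟨AddMonoidHom.mulLeft (q : ℤ), mul_right_injective₀ (by exact_mod_cast NeZero.ne q)⟩,
      mul_le_mul_iff_right₀ (by exact_mod_cast NeZero.pos q)⟩)

theorem ramifyFormal_coeff_of_not_dvd (q : ℕ) [NeZero q] (f : ℂ⸨X⸩) (n : ℤ) (hn : ¬ (q : ℤ) ∣ n) :
    (ramifyFormal q f).coeff n = 0 :=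
  HahnSeries.embDomain_of_notMem_range (by rintro ⟨m, rfl⟩; exact hn ⟨m, rfl⟩)

theorem IsConvergent.ramify {f : ℂ⸨X⸩} (hf : IsConvergent f) (q : ℕ) [NeZero q] :
    IsConvergent (ramifyFormal q f) := by
  obtain ⟨C, A, hC, hA, h⟩ := hf.shift 0
  refine ⟨C, A, fun n => ?_⟩
  by_cases hn : (q : ℤ) ∣ n
  · obtain ⟨m, rfl⟩ := Int.natCast_dvd_natCast.1 hn
    have h1 := h m
    rw [add_zero] at h1
    push_cast
    rw [ramifyFormal_coeff_mul]
    refine h1.trans (mul_le_mul_of_nonneg_left (pow_le_pow_right₀ hA ?_) hC)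
    exact Nat.le_mul_of_pos_left m (NeZero.pos q)
  · rw [ramifyFormal_coeff_of_not_dvd q f n hn, norm_zero]
    positivity

theorem eulerFormal_ramify (q : ℕ) [NeZero q] (f : ℂ⸨X⸩) :
    eulerFormal (ramifyFormal q f) = (q : ℂ) • ramifyFormal q (eulerFormal f) := by
  ext n
  rw [eulerFormal_coeff, HahnSeries.coeff_smul, smul_eq_mul]
  by_cases hn : (q : ℤ) ∣ n
  · obtain ⟨m, rfl⟩ := hn
    rw [ramifyFormal_coeff_mul, ramifyFormal_coeff_mul, eulerFormal_coeff]
    push_cast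
    ring
  · simp [ramifyFormal_coeff_of_not_dvd q _ n hn]

theorem rotate_ramify (q : ℕ) [NeZero q] (ζ : rootsOfUnity q ℂ) (f : ℂ⸨X⸩) :
    rotateFormal ζ (ramifyFormal q f) = ramifyFormal q f := by
  ext n
  rw [rotateFormal_coeff]
  by_cases hn : (q : ℤ) ∣ n
  · obtain ⟨m, rfl⟩ := hn
    have h : (ζ : ℂˣ) ^ q = 1 := ζ.2
    rw [zpow_mul, zpow_natCast, h]
    simp
  · simp [ramifyFormal_coeff_of_not_dvd q _ n hn]

/-! ### The ramified field `ℂ{y}[1/y]`, `y ^ q = x` -/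

/-- The field `ℂ{y}[1/y]`, seen as an extension of `ℂ{x}[1/x]` through `x = y ^ q`. -/
def Ramified (_q : ℕ) : Type := ConvLaurent

instance (q : ℕ) : Field (Ramified q) := inferInstanceAs (Field ConvLaurent)
instance (q : ℕ) : Algebra ℂ (Ramified q) := inferInstanceAs (Algebra ℂ ConvLaurent)
instance (q : ℕ) : Algebra (Ramified q) ℂ⸨X⸩ := inferInstanceAs (Algebra ConvLaurent ℂ⸨X⸩)
instance (q : ℕ) : IsScalarTower ℂ (Ramified q) ℂ⸨X⸩ :=
  inferInstanceAs (IsScalarTower ℂ ConvLaurent ℂ⸨X⸩)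

instance (q : ℕ) [NeZero q] : Algebra ConvLaurent (Ramified q) :=
  RingHom.toAlgebra (S := Ramified q)
    { toFun := fun f => (⟨ramifyFormal q f, IsConvergent.ramify f.2 q⟩ : ConvLaurent)
      map_zero' := Subtype.ext (map_zero (ramifyFormal q))
      map_one' := Subtype.ext (map_one (ramifyFormal q))
      map_add' := fun f g => Subtype.ext (map_add (ramifyFormal q) (f : ℂ⸨X⸩) g)
      map_mul' := fun f g => Subtype.ext (map_mul (ramifyFormal q) (f : ℂ⸨X⸩) g) }

instance (q : ℕ) [NeZero q] : IsScalarTower ℂ ConvLaurent (Ramified q) :=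
  IsScalarTower.of_algebraMap_eq fun c => Subtype.ext (by
    change algebraMap ℂ ℂ⸨X⸩ c = ramifyFormal q (algebraMap ℂ ℂ⸨X⸩ c)
    have : algebraMap ℂ ℂ⸨X⸩ c = HahnSeries.C c := rfl
    rw [this]
    exact HahnSeries.embDomainRingHom_C.symm)

/-- The derivation `y d/dy` of `ℂ{y}[1/y]`. -/
def eulerRam (q : ℕ) : Derivation ℂ (Ramified q) (Ramified q) := eulerConv

theorem eulerRam_algebraMap (q : ℕ) [NeZero q] (f : ConvLaurent) :
    eulerRam q (algebraMap ConvLaurent (Ramified q) f) =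
      (q : ℂ) • algebraMap ConvLaurent (Ramified q) (eulerConv f) :=
  Subtype.ext (eulerFormal_ramify q f)

theorem eulerFormal_algebraMap (q : ℕ) (f : Ramified q) :
    eulerFormal (algebraMap (Ramified q) ℂ⸨X⸩ f) =
      (1 : ℂ) • algebraMap (Ramified q) ℂ⸨X⸩ (eulerRam q f) := by
  rw [one_smul]
  rfl

/-- A `q`-th root of unity `ζ` acts on `ℂ{y}[1/y]` by `f(y) ↦ f(ζ y)`; this is linear over
`ℂ{x}[1/x]`. -/
def rotateRam (q : ℕ) [NeZero q] (ζ : rootsOfUnity q ℂ) :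
    Ramified q →ₗ[ConvLaurent] Ramified q where
  toFun f := (⟨rotateFormal ζ (algebraMap (Ramified q) ℂ⸨X⸩ f),
    IsConvergent.rotate (Subtype.property (p := fun f => f ∈ ConvLaurent) f) ζ⟩ : ConvLaurent)
  map_add' f g := Subtype.ext (map_add (rotateFormal ζ)
    (algebraMap (Ramified q) ℂ⸨X⸩ f) (algebraMap (Ramified q) ℂ⸨X⸩ g))
  map_smul' c f := Subtype.ext (by
    change rotateFormal ζ (ramifyFormal q c * algebraMap (Ramified q) ℂ⸨X⸩ f) =
      ramifyFormal q c * rotateFormal ζ (algebraMap (Ramified q) ℂ⸨X⸩ f)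
    rw [map_mul, rotate_ramify])

/-! ### Connections -/

section Connection

variable {F : Type*} [Field F] [Algebra ℂ F]

/-- A connection on an `F`-vector space `M`, where `F` is a field of (convergent or formal) Laurent
series in `x` and `δ = x d/dx`. It is given by the operator `θ = ∇_{x∂ₓ}`, so that
`∂ₓ = x⁻¹ θ` and `∇ m = θ m ⊗ dx / x`. -/
structure Connection (δ : Derivation ℂ F F) (M : Type*) [AddCommGroup M] [Module ℂ M]
    [Module F M] where
  /-- The operator `∇_{x∂ₓ}`. -/
  θ : M →ₗ[ℂ] M
  leibniz : ∀ (f : F) (m : M), θ (f • m) = δ f • m + f • θ m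

variable {F' : Type*} [Field F'] [Algebra ℂ F'] [Algebra F F'] [IsScalarTower ℂ F F']
  {δ : Derivation ℂ F F} {δ' : Derivation ℂ F' F'}

/-- Pull-back of a connection along a field extension `F ⊆ F'` on which `δ' = c δ`:
on `F' ⊗ M` the operator is `g ⊗ m ↦ δ' g ⊗ m + c g ⊗ θ m`. -/
def Connection.baseChange {M : Type*} [AddCommGroup M] [Module ℂ M] [Module F M]
    (D : Connection δ M) (c : ℂ)
    (h : ∀ f, δ' (algebraMap F F' f) = c • algebraMap F F' (δ f)) :
    Connection δ' (F' ⊗[F] M) :=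
  let T : F' ⊗[F] M →+ F' ⊗[F] M := TensorProduct.liftAddHom
    { toFun := fun g =>
        { toFun := fun m => δ' g ⊗ₜ m + (c • g) ⊗ₜ D.θ m
          map_zero' := by simp
          map_add' := fun m m' => by simp only [map_add, TensorProduct.tmul_add]; abel }
      map_zero' := by ext m; simp
      map_add' := fun g g' => by
        ext m
        simp only [map_add, smul_add, TensorProduct.add_tmul, AddMonoidHom.coe_mk, ZeroHom.coe_mk,
          AddMonoidHom.add_apply]
        abel }
    (fun f g m => by
      simp only [AddMonoidHom.coe_mk, ZeroHom.coe_mk, D.leibniz, TensorProduct.tmul_add]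
      rw [Algebra.smul_def f g, Derivation.leibniz, h, TensorProduct.add_tmul,
        ← TensorProduct.smul_tmul f (δ' g), ← TensorProduct.smul_tmul (δ f),
        ← TensorProduct.smul_tmul f, Algebra.smul_def f (δ' g), Algebra.smul_def (δ f),
        Algebra.smul_def f (c • g)]
      simp only [smul_eq_mul, mul_smul_comm, smul_mul_assoc, mul_comm g]
      abel)
  have hT : ∀ (a g : F') (m : M), T ((a * g) ⊗ₜ m) = (δ' a * g) ⊗ₜ m + a • T (g ⊗ₜ m) := by
    intro a g m
    simp only [T, TensorProduct.liftAddHom_tmul, AddMonoidHom.coe_mk, ZeroHom.coe_mk,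
      Derivation.leibniz, TensorProduct.add_tmul, smul_add, TensorProduct.smul_tmul', smul_eq_mul,
      mul_smul_comm, mul_comm g]
    abel
  { θ :=
      { toFun := T
        map_add' := map_add T
        map_smul' := fun a z => by
          induction z with
          | zero => simp
          | add z w hz hw => rw [smul_add, map_add, hz, hw, map_add, smul_add]
          | tmul g m =>
            rw [TensorProduct.smul_tmul', Algebra.smul_def, hT, Derivation.map_algebraMap]
            simp [algebraMap_smul] }
    leibniz := fun a z => by
      change T (a • z) = δ' a • z + a • T z
      induction z with
      | zero => simp
      | add z w hz hw => rw [smul_add, map_add, hz, hw, map_add, smul_add, smul_add]; abel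
      | tmul g m =>
        rw [TensorProduct.smul_tmul', smul_eq_mul, hT, TensorProduct.smul_tmul', smul_eq_mul] }

theorem Connection.baseChange_tmul {M : Type*} [AddCommGroup M] [Module ℂ M] [Module F M]
    (D : Connection δ M) (c : ℂ) (h : ∀ f, δ' (algebraMap F F' f) = c • algebraMap F F' (δ f))
    (g : F') (m : M) :
    (D.baseChange c h).θ (g ⊗ₜ[F] m) = δ' g ⊗ₜ[F] m + (c • g) ⊗ₜ[F] D.θ m :=
  rfl

/-- The connection `E^φ ⊗ R` for a Laurent series `φ`: the space `R` (`e^φ ⊗ m` being identified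
with `m`), with the operator `m ↦ θ m + δ(φ) m`. -/
def Connection.expTwist {R : Type*} [AddCommGroup R] [Module ℂ R] [Module F R]
    [IsScalarTower ℂ F R] (D : Connection δ R) (φ : F) : Connection δ R where
  θ := D.θ + Algebra.lsmul ℂ ℂ R (δ φ)
  leibniz f m := by
    simp only [LinearMap.add_apply, Algebra.lsmul_coe, D.leibniz, smul_add]
    rw [smul_comm (δ φ) f m, add_assoc]

/-- The direct sum of finitely many connections. -/
def Connection.pi {ι : Type*} [Finite ι] {R : ι → Type*} [∀ i, AddCommGroup (R i)]
    [∀ i, Module ℂ (R i)] [∀ i, Module F (R i)] (D : ∀ i, Connection δ (R i)) :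
    Connection δ (∀ i, R i) where
  θ := LinearMap.pi fun i => (D i).θ ∘ₗ LinearMap.proj i
  leibniz f m := by
    ext i
    simp [(D i).leibniz]

end Connection

/-! ### The Deligne filtration of a meromorphic connection -/

section Deligne

variable {M : Type*} [AddCommGroup M] [Module ℂ M] [Module ConvLaurent M]
  [IsScalarTower ℂ ConvLaurent M]

/-- The ring `ℂ{x}⟨x∂ₓ⟩`, through its action on `M`: the algebra of operators on `M` generated by
the multiplications by convergent power series and by `∇_{x∂ₓ}`. -/
def logDiffOps (D : Connection eulerConv M) : Subalgebra ℂ (Module.End ℂ M) :=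
  Algebra.adjoin ℂ ({D.θ} ∪ (fun f : ConvLaurent => Algebra.lsmul ℂ ℂ M f) '' ConvPower)

/-- The ring `logDiffOps D`, as a type. -/
def LogOps (D : Connection eulerConv M) : Type _ := logDiffOps D

instance (D : Connection eulerConv M) : Ring (LogOps D) := inferInstanceAs (Ring (logDiffOps D))
instance (D : Connection eulerConv M) : Algebra ℂ (LogOps D) :=
  inferInstanceAs (Algebra ℂ (logDiffOps D))
instance (D : Connection eulerConv M) : Module (LogOps D) M :=
  inferInstanceAs (Module (logDiffOps D) M)
instance (D : Connection eulerConv M) : IsScalarTower ℂ (LogOps D) M :=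
  inferInstanceAs (IsScalarTower ℂ (logDiffOps D) M)

/-- The operator `x∂ₓ`, as an element of `ℂ{x}⟨x∂ₓ⟩`. -/
def LogOps.xdx (D : Connection eulerConv M) : LogOps D :=
  (⟨D.θ, Algebra.subset_adjoin (Or.inl rfl)⟩ : logDiffOps D)

theorem LogOps.xdx_smul (D : Connection eulerConv M) (m : M) : LogOps.xdx D • m = D.θ m := rfl

/-- `V^{>b} = ⋃_{c > b} V^c`. -/
def filtGt {D : Connection eulerConv M} (V : ℝ → Submodule (LogOps D) M) (b : ℝ) :
    Submodule (LogOps D) M :=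
  ⨆ c : Set.Ioi b, V c

/-- `gr^b_V = V^b / V^{>b}`. -/
abbrev Gr {D : Connection eulerConv M} (V : ℝ → Submodule (LogOps D) M) (b : ℝ) : Type _ :=
  V b ⧸ (filtGt V b).submoduleOf (V b)

/-- `V` is the Deligne filtration of the meromorphic connection `(M, D)`: an exhaustive, decreasing,
left-continuous filtration indexed by `ℝ` by finitely generated `ℂ{x}⟨x∂ₓ⟩`-submodules, with
`x V^b = V^{b+1}`, whose graded pieces `gr^b_V` are finite dimensional with all the eigenvalues of
`x∂ₓ` on `gr^b_V` of real part `b`. -/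
structure IsDeligneFiltration (D : Connection eulerConv M)
    (V : ℝ → Submodule (LogOps D) M) : Prop where
  antitone : Antitone V
  exhaustive : ⨆ b, V b = ⊤
  left_continuous : ∀ b, ⨅ c : Set.Iio b, V c = V b
  fg : ∀ b, (V b).FG
  mul_x : ∀ b (m : M), coordX • m ∈ V (b + 1) ↔ m ∈ V b
  finite_gr : ∀ b, FiniteDimensional ℂ (Gr V b)
  eigenvalue_re : ∀ b (β : ℂ),
    Module.End.HasEigenvalue (Algebra.lsmul ℂ ℂ (Gr V b) (LogOps.xdx D)) β → β.re = b

end Deligne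

/-! ### Formal regular singular connections and their Deligne lattices -/

section Formal

variable {R : Type*} [AddCommGroup R] [Module ℂ R] [Module ℂ⸨X⸩ R]

/-- A logarithmic lattice: a finitely generated `ℂ[[y]]`-submodule which generates `R` over `ℂ((y))`
and is stable by `∇_{y∂_y}`. -/
structure IsLogLattice (D : Connection eulerFormal R)
    (L : Submodule (LaurentSeries.powerSeries_as_subring ℂ) R) : Prop where
  fg : L.FG
  span_eq_top : Submodule.span ℂ⸨X⸩ (L : Set R) = ⊤
  stable : ∀ m ∈ L, D.θ m ∈ L

/-- Regular singularity: there is a logarithmic lattice. -/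
def IsRegularSingular (D : Connection eulerFormal R) : Prop :=
  ∃ L, IsLogLattice D L

/-- `L` is a logarithmic lattice such that the eigenvalues of the residue of the connection, that is
of the endomorphism induced by `∇_{y∂_y}` on `L / y L`, have real part in `[b, b + 1)`. -/
structure IsDeligneLattice (D : Connection eulerFormal R) (b : ℝ)
    (L : Submodule (LaurentSeries.powerSeries_as_subring ℂ) R) : Prop
    extends IsLogLattice D L where
  residue_re : ∀ (β : ℂ), ∀ m ∈ L,
    (¬ ∃ m' ∈ L, m = (HahnSeries.single 1 1 : ℂ⸨X⸩) • m') →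
    (∃ m' ∈ L, D.θ m - β • m = (HahnSeries.single 1 1 : ℂ⸨X⸩) • m') →
    b ≤ β.re ∧ β.re < b + 1

/-- `V^b R`: the (unique) Deligne lattice of index `b` of a formal regular singular connection. -/
def deligneLattice (D : Connection eulerFormal R) (b : ℝ) :
    Submodule (LaurentSeries.powerSeries_as_subring ℂ) R :=
  sSup {L | IsDeligneLattice D b L}

end Formal

/-! ### Formal elementary models and the canonical parabolic filtration -/

/-- The Laurent polynomial `φ(1/y)`. -/
def polarPart (φ : Polynomial ℂ) : ℂ⸨X⸩ :=
  Polynomial.aeval (HahnSeries.single (-1) 1 : ℂ⸨X⸩) φ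

/-- An elementary model of a formal connection `(W, D)`: a finite set `Φ ⊆ y⁻¹ℂ[y⁻¹]`, regular
singular connections `R_φ` and an isomorphism of connections `W ≃ ⨁_{φ ∈ Φ} E^φ ⊗ R_φ`. -/
structure ElementaryModel.{w, v} {W : Type v} [AddCommGroup W] [Module ℂ W] [Module ℂ⸨X⸩ W]
    (D : Connection eulerFormal W) where
  /-- The exponents, as polynomials without constant term in `1/y`. -/
  Φ : Finset (Polynomial ℂ)
  coeff_zero : ∀ φ ∈ Φ, φ.coeff 0 = 0
  /-- The spaces `R_φ`. -/
  R : Φ → Type w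
  [addCommGroup : ∀ φ, AddCommGroup (R φ)]
  [moduleC : ∀ φ, Module ℂ (R φ)]
  [module : ∀ φ, Module ℂ⸨X⸩ (R φ)]
  [tower : ∀ φ, IsScalarTower ℂ ℂ⸨X⸩ (R φ)]
  /-- The connections on the spaces `R_φ`. -/
  conn : ∀ φ, Connection eulerFormal (R φ)
  regular : ∀ φ, IsRegularSingular (conn φ)
  /-- The isomorphism. -/
  iso : W ≃ₗ[ℂ⸨X⸩] ∀ φ, R φ
  iso_conn : ∀ z,
    iso (D.θ z) = (Connection.pi fun φ => (conn φ).expTwist (polarPart φ)).θ (iso z)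

attribute [instance] ElementaryModel.addCommGroup ElementaryModel.moduleC ElementaryModel.module
  ElementaryModel.tower

/-- `P^b(W) = ⨁_φ E^φ ⊗ V^b R_φ`. -/
def ElementaryModel.parabolicFormal {W : Type*} [AddCommGroup W] [Module ℂ W] [Module ℂ⸨X⸩ W]
    {D : Connection eulerFormal W} (E : ElementaryModel D) (b : ℝ) : Set W :=
  {z | ∀ φ, E.iso z φ ∈ deligneLattice (E.conn φ) b}

section Main

variable {M : Type*} [AddCommGroup M] [Module ℂ M] [Module ConvLaurent M]

/-- The underlying space of `N = π⁺M`, for `π : y ↦ x = y ^ q`. -/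
abbrev RamPullback (q : ℕ) [NeZero q] (M : Type*) [AddCommGroup M] [Module ConvLaurent M] :
    Type _ :=
  Ramified q ⊗[ConvLaurent] M

/-- The connection on `N = π⁺M`: `y∂_y (g ⊗ m) = y g'(y) ⊗ m + q g ⊗ x∂ₓ m`. -/
def Connection.ramPullback (D : Connection eulerConv M) (q : ℕ) [NeZero q] :
    Connection (eulerRam q) (RamPullback q M) :=
  D.baseChange (q : ℂ) (eulerRam_algebraMap q)

/-- The formalization `ℂ((y)) ⊗ N` of a connection `N` over `ℂ{y}[1/y]`. -/
def Connection.formalization {q : ℕ} {N : Type*} [AddCommGroup N] [Module ℂ N]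
    [Module (Ramified q) N] (D : Connection (eulerRam q) N) :
    Connection eulerFormal (ℂ⸨X⸩ ⊗[Ramified q] N) :=
  D.baseChange 1 (eulerFormal_algebraMap q)

/-- The action of a `q`-th root of unity on `N = π⁺M`: `g(y) ⊗ m ↦ g(ζ y) ⊗ m`. -/
def galoisAct (q : ℕ) [NeZero q] (M : Type*) [AddCommGroup M] [Module ConvLaurent M]
    (ζ : rootsOfUnity q ℂ) : RamPullback q M →ₗ[ConvLaurent] RamPullback q M :=
  LinearMap.rTensor M (rotateRam q ζ)

variable {D : Connection eulerConv M} {q : ℕ} [NeZero q]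

/-- `P^b(N) = P^b(N^) ∩ N`, for `N = π⁺M` with formalization `N^`. -/
def parabolicRam (E : ElementaryModel (D.ramPullback q).formalization) (b : ℝ) :
    Set (RamPullback q M) :=
  {n | (1 : ℂ⸨X⸩) ⊗ₜ[Ramified q] n ∈ E.parabolicFormal b}

/-- The canonical parabolic filtration of `M`: `P^b(M)` is the set of invariants of `P^{qb}(N)`
under the `q`-th roots of unity, `M` being identified with the invariants of `N = π⁺M` through
`m ↦ 1 ⊗ m`. -/
def parabolic (E : ElementaryModel (D.ramPullback q).formalization) (b : ℝ) : Set M :=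
  {m | (1 : Ramified q) ⊗ₜ[ConvLaurent] m ∈
    {n ∈ parabolicRam E (q * b) | ∀ ζ, galoisAct q M ζ n = n}}

end Main

end MeroConn

end

/-!
Write `θ = y∂_y`. The lattice `V^b R` of a formal regular connection consists of the elements sent
arbitrarily deep into a logarithmic lattice by polynomials `p(θ)` whose roots all have real part at
least `b`. In this form it is visibly intrinsic and functorial.

On a summand `E^φ ⊗ R_φ` with `φ ≠ 0` the operator `θ` becomes `θ + χ`, where `χ = y φ'(y)` has
negative order. The identity `χ m = (θ + χ) m - θ m` shows that a module over the differential
operators containing one lattice of this summand contains all of them. So the only condition that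
survives in the module generated by `𝒫^b(M)` is the one on the component with `φ = 0`, and `V^b M`
is the set of the `m` for which the component of `1 ⊗ m` in `R_0` belongs to `V^{qb} R_0`. Elements
of the formal module are approximated, up to arbitrarily deep steps of the parabolic filtration, by
elements of `N`, and averaging over the `q`-th roots of unity descends them to `M`.

For uniqueness, let `V` and `V'` be two Deligne filtrations. As `V` has only finitely many jumps
modulo `ℤ`, an element of `V^b` is sent into `V'^b` by a polynomial in `x∂_x` whose roots have real
part at least `b`. No such root is an eigenvalue of `x∂_x` on `gr^e_{V'}` for `e < b`, so the
element belongs to `V'^b` already.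
-/

noncomputable section

namespace MeroConn

section Operators

open Polynomial

/-- The nonzero polynomials whose roots all have real part at least `b`. -/
def RootsGE (b : ℝ) (p : ℂ[X]) : Prop := p ≠ 0 ∧ ∀ β, p.IsRoot β → b ≤ β.re

theorem rootsGE_one (b : ℝ) : RootsGE b 1 :=
  ⟨one_ne_zero, fun β h => by simp [IsRoot.def] at h⟩

theorem RootsGE.mul {b : ℝ} {p p' : ℂ[X]} (hp : RootsGE b p) (hp' : RootsGE b p') :
    RootsGE b (p * p') :=
  ⟨mul_ne_zero hp.1 hp'.1, fun β h => (root_mul.1 h).elim (hp.2 β) (hp'.2 β)⟩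

theorem RootsGE.mono {b c : ℝ} (h : b ≤ c) {p : ℂ[X]} (hp : RootsGE c p) : RootsGE b p :=
  ⟨hp.1, fun β hβ => h.trans (hp.2 β hβ)⟩

theorem RootsGE.comp_X_sub_C {b : ℝ} {p : ℂ[X]} (hp : RootsGE b p) (c : ℂ) :
    RootsGE (b + c.re) (p.comp (X - C c)) := by
  refine ⟨fun h => hp.1 ?_, fun β hβ => ?_⟩
  · have hcomp := congrArg (fun r => r.comp (X + C c)) h
    simpa [comp_assoc] using hcomp
  · have hre := hp.2 (β - c) (by simpa [IsRoot.def, eval_comp] using hβ)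
    rw [Complex.sub_re] at hre
    linarith

theorem rootsGE_X_sub_C {b : ℝ} {β : ℂ} (h : b ≤ β.re) : RootsGE b (X - C β) :=
  ⟨X_sub_C_ne_zero β, fun γ hγ => by rwa [← root_X_sub_C.1 hγ]⟩

variable {k E E' : Type*} [Field k] [AddCommGroup E] [Module k E] [AddCommGroup E'] [Module k E']
  {θ : Module.End k E} {A B F : Submodule k E} {β : k} {m : E}

/-- The vector `m` is an eigenvector of `θ` modulo the subspace `A`, for the eigenvalue `β`.
The subspace `A` is not required to be `θ`-stable, so that `θ` need not act on `E ⧸ A`. -/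
structure IsEigenvectorMod (θ : Module.End k E) (A : Submodule k E) (β : k) (m : E) : Prop where
  notMem : m ∉ A
  sub_smul_mem : θ m - β • m ∈ A

theorem exists_dvd_aeval_mem_forall_isEigenvectorMod {p : k[X]} (hp : p ≠ 0)
    (hpm : aeval θ p m ∈ A) : ∃ g, g ∣ p ∧ aeval θ g m ∈ A ∧
      ∀ β, g.IsRoot β → ∃ h : k[X], IsEigenvectorMod θ A β (aeval θ h m) := by
  induction hn : p.natDegree using Nat.strong_induction_on generalizing p with
  | _ n ih =>
    by_cases hall : ∀ β, p.IsRoot β → ∃ h : k[X], IsEigenvectorMod θ A β (aeval θ h m)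
    · exact ⟨p, dvd_rfl, hpm, hall⟩
    push Not at hall
    obtain ⟨β, hβ, hnot⟩ := hall
    obtain ⟨h, rfl⟩ := dvd_iff_isRoot.2 hβ
    have hh0 : h ≠ 0 := right_ne_zero_of_mul hp
    have hhm : aeval θ h m ∈ A := by
      by_contra hc
      exact hnot h ⟨hc, by simpa [sub_mul, Module.End.mul_apply] using hpm⟩
    have hdeg : h.natDegree < n := by
      rw [← hn, natDegree_mul (X_sub_C_ne_zero β) hh0, natDegree_X_sub_C]
      omega
    obtain ⟨g, hg, hgm, hgr⟩ := ih h.natDegree hdeg hh0 hhm rfl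
    exact ⟨g, hg.mul_left _, hgm, hgr⟩

theorem exists_isRoot_isEigenvectorMod [IsAlgClosed k] (hm : m ∉ A) {p : k[X]} (hp : p ≠ 0)
    (hpm : aeval θ p m ∈ A) :
    ∃ β, p.IsRoot β ∧ ∃ h : k[X], IsEigenvectorMod θ A β (aeval θ h m) := by
  obtain ⟨g, hgp, hgm, hgr⟩ := exists_dvd_aeval_mem_forall_isEigenvectorMod hp hpm
  have hdeg : g.degree ≠ 0 := by
    intro hd
    have hg0 : g.coeff 0 ≠ 0 := fun h0 => ne_zero_of_dvd_ne_zero hp hgp (by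
      rw [eq_C_of_degree_eq_zero hd, h0, C_0])
    rw [eq_C_of_degree_eq_zero hd, aeval_C, Module.algebraMap_end_apply] at hgm
    exact hm ((A.smul_mem_iff hg0).1 hgm)
  obtain ⟨β, hβ⟩ := IsAlgClosed.exists_root g hdeg
  exact ⟨β, hβ.dvd hgp, hgr β hβ⟩

theorem IsEigenvectorMod.aeval_sub_eval_smul_mem (h : IsEigenvectorMod θ A β m)
    (hA : ∀ m ∈ A, θ m ∈ A) (p : k[X]) : aeval θ p m - p.eval β • m ∈ A := by
  obtain ⟨r, hr⟩ := X_sub_C_dvd_sub_C_eval (a := β) (p := p)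
  have hfactor : aeval θ p m - p.eval β • m = aeval θ r (θ m - β • m) := by
    simpa [mul_comm _ r, Module.End.mul_apply] using congrArg (fun s => aeval θ s m) hr
  rw [hfactor]
  exact aeval_apply_smul_mem_of_le_comap h.sub_smul_mem r θ hA

theorem IsEigenvectorMod.isRoot (h : IsEigenvectorMod θ A β m) (hA : ∀ m ∈ A, θ m ∈ A) {p : k[X]}
    (hp : aeval θ p m ∈ A) : p.IsRoot β := by
  by_contra hβ
  have heval := A.sub_mem hp (h.aeval_sub_eval_smul_mem hA p)
  rw [sub_sub_cancel] at heval
  exact h.notMem ((A.smul_mem_iff hβ).1 heval)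

theorem aeval_comp_X_sub_C_apply {θ' : Module.End k E'} {f : E →ₗ[k] E'} {c : k}
    (hf : ∀ m, θ' (f m) = f (θ m) + c • f m) (p : k[X]) (m : E) :
    aeval θ' (p.comp (X - C c)) (f m) = f (aeval θ p m) := by
  induction p using Polynomial.induction_on generalizing m with
  | C a => simp
  | add p p' h h' => simp [h, h']
  | monomial n a ih =>
    rw [pow_succ, ← mul_assoc, mul_comp, X_comp, map_mul, map_mul, Module.End.mul_apply,
      Module.End.mul_apply, aeval_X, ← ih]
    simp [hf]

theorem aeval_apply_of_comm {θ' : Module.End k E'} {f : E →ₗ[k] E'}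
    (hf : ∀ m, θ' (f m) = f (θ m)) (p : k[X]) (m : E) :
    aeval θ' p (f m) = f (aeval θ p m) := by
  simpa using aeval_comp_X_sub_C_apply (c := 0) (by simpa using hf) p m

theorem finiteDimensional_quotient_of_le_sup [FiniteDimensional k F] (h : B ≤ F ⊔ A) :
    FiniteDimensional k (B ⧸ A.submoduleOf B) := by
  let f : B →ₗ[k] E ⧸ A := A.mkQ ∘ₗ B.subtype
  have hker : LinearMap.ker f = A.submoduleOf B := by
    rw [LinearMap.ker_comp, Submodule.ker_mkQ, Submodule.submoduleOf]
  have hrange : LinearMap.range f ≤ F.map A.mkQ := by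
    rw [LinearMap.range_comp, Submodule.range_subtype, Submodule.map_le_iff_le_comap,
      Submodule.comap_map_mkQ, sup_comm]
    exact h
  have : FiniteDimensional k (LinearMap.range f) := Submodule.finiteDimensional_of_le hrange
  rw [← hker]
  exact f.quotKerEquivRange.symm.finiteDimensional

theorem exists_forall_aeval_mem [FiniteDimensional k (B ⧸ A.submoduleOf B)]
    (hA : ∀ m ∈ A, θ m ∈ A) (hB : ∀ m ∈ B, θ m ∈ B) :
    ∃ p : k[X], p ≠ 0 ∧ ∀ m ∈ B, aeval θ p m ∈ A := by
  let θB : Module.End k B := θ.restrict hB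
  let θQ : Module.End k (B ⧸ A.submoduleOf B) := (A.submoduleOf B).mapQ _ θB fun m => hA m
  refine ⟨minpoly k θQ, minpoly.ne_zero_of_finite k θQ, fun m hm => ?_⟩
  have hmk : (A.submoduleOf B).mkQ (aeval θB (minpoly k θQ) ⟨m, hm⟩) = 0 := by
    rw [← aeval_apply_of_comm (θ := θB) (θ' := θQ) fun _ => rfl, minpoly.aeval,
      LinearMap.zero_apply]
  rw [Submodule.mkQ_apply, Submodule.Quotient.mk_eq_zero] at hmk
  change B.subtype (aeval θB (minpoly k θQ) ⟨m, hm⟩) ∈ A at hmk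
  rwa [← aeval_apply_of_comm (θ := θB) (θ' := θ) fun _ => rfl] at hmk

end Operators

section Series

/-- The ring `ℂ[[y]]`, as a subring of `ℂ((y))`. -/
abbrev FormalPower : Subring ℂ⸨X⸩ := LaurentSeries.powerSeries_as_subring ℂ

/-- The monomial `y ^ n`. -/
abbrev yPow (n : ℤ) : ℂ⸨X⸩ := HahnSeries.single n 1

theorem yPow_mul (m n : ℤ) : yPow m * yPow n = yPow (m + n) := by
  rw [HahnSeries.single_mul_single, one_mul]

theorem yPow_zero : yPow 0 = 1 := rfl

theorem yPow_neg_mul (n : ℤ) : yPow (-n) * yPow n = 1 := by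
  rw [yPow_mul, neg_add_cancel, yPow_zero]

theorem yPow_mul_neg (n : ℤ) : yPow n * yPow (-n) = 1 := by
  rw [yPow_mul, add_neg_cancel, yPow_zero]

theorem yPow_ne_zero (n : ℤ) : yPow n ≠ 0 := HahnSeries.single_ne_zero one_ne_zero

theorem weightSeries_yPow (w : ℤ → ℂ) (n : ℤ) : weightSeries w (yPow n) = w n • yPow n := by
  ext k
  rw [weightSeries_coeff, HahnSeries.coeff_smul, HahnSeries.coeff_single]
  split_ifs with h <;> simp [h]

theorem eulerFormal_yPow (n : ℤ) : eulerFormal (yPow n) = (n : ℂ) • yPow n :=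
  weightSeries_yPow _ n

theorem rotateFormal_yPow (ζ : ℂˣ) (n : ℤ) :
    rotateFormal ζ (yPow n) = ((ζ ^ n : ℂˣ) : ℂ) • yPow n :=
  weightSeries_yPow _ n

theorem mem_formalPower_iff {f : ℂ⸨X⸩} : f ∈ FormalPower ↔ ∀ n < 0, f.coeff n = 0 := by
  have hrange : f ∈ FormalPower ↔ ∃ p : ℂ⟦X⟧, (p : ℂ⸨X⸩) = f := by
    simp [FormalPower, LaurentSeries.powerSeries_as_subring]
  rw [hrange, ← LaurentSeries.val_le_one_iff_eq_coe]
  simpa using LaurentSeries.valuation_le_iff_coeff_lt_eq_zero ℂ (D := 0) (f := f)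

theorem mem_formalPower_iff_order {f : ℂ⸨X⸩} : f ∈ FormalPower ↔ 0 ≤ f.order := by
  rw [mem_formalPower_iff]
  refine ⟨fun h => ?_, fun h n hn => HahnSeries.coeff_eq_zero_of_lt_order (hn.trans_le h)⟩
  by_contra! hneg
  have hf := HahnSeries.coeff_order_eq_zero.1 (h _ hneg)
  simp [hf] at hneg

theorem yPow_mem {n : ℤ} (hn : 0 ≤ n) : yPow n ∈ FormalPower := by
  rwa [mem_formalPower_iff_order, HahnSeries.order_single one_ne_zero]

theorem order_yPow_mul (n : ℤ) {f : ℂ⸨X⸩} (hf : f ≠ 0) : (yPow n * f).order = n + f.order := by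
  rw [HahnSeries.order_mul (yPow_ne_zero n) hf, HahnSeries.order_single one_ne_zero]

theorem yPow_mul_mem {n : ℤ} {f : ℂ⸨X⸩} (h : 0 ≤ n + f.order) : yPow n * f ∈ FormalPower := by
  rcases eq_or_ne f 0 with rfl | hf
  · rw [mul_zero]
    exact zero_mem _
  · rwa [mem_formalPower_iff_order, order_yPow_mul n hf]

theorem order_inv_of_ne_zero {f : ℂ⸨X⸩} (hf : f ≠ 0) : (f⁻¹).order = -f.order := by
  have hmul := HahnSeries.order_mul hf (inv_ne_zero hf)
  rw [mul_inv_cancel₀ hf, HahnSeries.order_one] at hmul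
  omega

theorem yPow_neg_one_mul_inv_mem {f : ℂ⸨X⸩} (h : f.order < 0) :
    yPow (-1) * f⁻¹ ∈ FormalPower := by
  have hf : f ≠ 0 := fun h0 => by simp [h0] at h
  exact yPow_mul_mem (by rw [order_inv_of_ne_zero hf]; omega)

theorem algebraMap_mem_formalPower (c : ℂ) : algebraMap ℂ ℂ⸨X⸩ c ∈ FormalPower :=
  mem_formalPower_iff.2 fun _ hn => HahnSeries.coeff_single_of_ne hn.ne

theorem rotateFormal_mem {f : ℂ⸨X⸩} (ζ : ℂˣ) (h : f ∈ FormalPower) :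
    rotateFormal ζ f ∈ FormalPower := by
  rw [mem_formalPower_iff] at h ⊢
  intro n hn
  rw [rotateFormal_coeff, h n hn, mul_zero]

instance : IsNoetherianRing FormalPower :=
  isNoetherianRing_of_ringEquiv _ (LaurentSeries.powerSeriesEquivSubring ℂ)

theorem mem_convPower {f : ConvLaurent} : f ∈ ConvPower ↔ (f : ℂ⸨X⸩) ∈ FormalPower := Iff.rfl

theorem coordX_ne_zero : coordX ≠ 0 := fun h => yPow_ne_zero 1 (congrArg Subtype.val h)

theorem coe_coordX_zpow (n : ℤ) : ((coordX ^ n : ConvLaurent) : ℂ⸨X⸩) = yPow n := by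
  rw [yPow, RatFunc.single_zpow]
  exact map_zpow₀ ConvLaurent.val coordX n

theorem exists_eq_zpow_mul {a : ConvLaurent} (ha : a ≠ 0) :
    ∃ (n : ℤ) (u : ConvLaurent), a = coordX ^ n * u ∧ u ∈ ConvPower ∧ u⁻¹ ∈ ConvPower := by
  have ha' : (a : ℂ⸨X⸩) ≠ 0 := fun h => ha (Subtype.ext h)
  set n := (a : ℂ⸨X⸩).order
  have hu : ((coordX ^ (-n) * a : ConvLaurent) : ℂ⸨X⸩) = yPow (-n) * a := by
    rw [MulMemClass.coe_mul, coe_coordX_zpow]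
  refine ⟨n, coordX ^ (-n) * a, ?_, ?_, ?_⟩
  · rw [← mul_assoc, ← zpow_add₀ coordX_ne_zero, add_neg_cancel, zpow_zero, one_mul]
  · rw [mem_convPower, hu]
    exact yPow_mul_mem (by omega)
  · rw [mem_convPower, IntermediateField.coe_inv, hu, mem_formalPower_iff_order,
      order_inv_of_ne_zero (mul_ne_zero (yPow_ne_zero _) ha'), order_yPow_mul _ ha']
    omega

theorem exists_eq_algebraMap_add_yPow_mul {f : ℂ⸨X⸩} (h : f ∈ FormalPower) :
    ∃ c : ℂ, ∃ g ∈ FormalPower, f = algebraMap ℂ ℂ⸨X⸩ c + yPow 1 * g := by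
  refine ⟨f.coeff 0, yPow (-1) * (f - algebraMap ℂ ℂ⸨X⸩ (f.coeff 0)), ?_, ?_⟩
  · rw [mem_formalPower_iff] at h ⊢
    intro n hn
    rw [HahnSeries.coeff_single_mul, one_mul, HahnSeries.coeff_sub]
    change _ - (HahnSeries.single 0 (f.coeff 0)).coeff _ = 0
    rw [HahnSeries.coeff_single]
    split_ifs with h0
    · rw [h0, sub_self]
    · rw [h _ (by omega), sub_zero]
  · rw [← mul_assoc, yPow_mul_neg, one_mul]
    ring

/-- The polynomials of degree less than `k` in the coordinate, where the truncations of power series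
at order `k` live. -/
def truncations (k : ℕ) : Submodule ℂ ConvLaurent :=
  Submodule.span ℂ ((coordX ^ ·) '' Set.Iio k)

instance (k : ℕ) : FiniteDimensional ℂ (truncations k) :=
  FiniteDimensional.span_of_finite ℂ ((Set.finite_Iio k).image _)

theorem exists_truncation_formalPower {f : ℂ⸨X⸩} (hf : f ∈ FormalPower) (k : ℕ) :
    ∃ a ∈ truncations k, ∃ g ∈ FormalPower, f = a + yPow k * g := by
  induction k with
  | zero => exact ⟨0, zero_mem _, f, hf, by simp⟩
  | succ k ih =>
    obtain ⟨a, ha, g, hg, rfl⟩ := ih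
    obtain ⟨c, g', hg', rfl⟩ := exists_eq_algebraMap_add_yPow_mul hg
    have hle : truncations k ≤ truncations (k + 1) :=
      Submodule.span_mono (Set.image_mono (Set.Iio_subset_Iio k.le_succ))
    have hmem : coordX ^ k ∈ truncations (k + 1) :=
      Submodule.subset_span ⟨k, k.lt_succ_self, rfl⟩
    refine ⟨a + c • coordX ^ k, add_mem (hle ha) (Submodule.smul_mem _ c hmem), g', hg', ?_⟩
    rw [AddMemClass.coe_add, IntermediateField.coe_smul, ← zpow_natCast, coe_coordX_zpow,
      Algebra.smul_def, Nat.cast_succ, ← yPow_mul]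
    ring

theorem exists_truncation_convPower {a : ConvLaurent} (ha : a ∈ ConvPower) (k : ℕ) :
    ∃ f ∈ truncations k, ∃ u ∈ ConvPower, a = f + coordX ^ k * u := by
  obtain ⟨f, hf, g, hg, he⟩ := exists_truncation_formalPower (mem_convPower.1 ha) k
  refine ⟨f, hf, coordX ^ (-k : ℤ) * (a - f), ?_, ?_⟩
  · rw [mem_convPower, MulMemClass.coe_mul, coe_coordX_zpow, AddSubgroupClass.coe_sub, he,
      add_sub_cancel_left, ← mul_assoc, yPow_neg_mul, one_mul]
    exact hg
  · rw [← mul_assoc, ← zpow_natCast, ← zpow_add₀ coordX_ne_zero, add_neg_cancel, zpow_zero, one_mul,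
      add_sub_cancel]

theorem exists_convLaurent_add_yPow_mul (f : ℂ⸨X⸩) (k : ℕ) :
    ∃ a : ConvLaurent, ∃ g ∈ FormalPower, f = a + yPow k * g := by
  set n := f.order
  obtain ⟨a, -, g, hg, he⟩ := exists_truncation_formalPower
    (yPow_mul_mem (n := -n) (f := f) (by omega)) (k + n.natAbs)
  refine ⟨coordX ^ n * a, yPow (n + n.natAbs) * g, mul_mem (yPow_mem (by omega)) hg, ?_⟩
  calc f = yPow n * (yPow (-n) * f) := by rw [← mul_assoc, yPow_mul_neg, one_mul]
    _ = yPow n * a + yPow (n + (k + n.natAbs)) * g := by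
      rw [he, mul_add, ← mul_assoc, yPow_mul, Nat.cast_add]
    _ = (coordX ^ n * a : ConvLaurent) + yPow k * (yPow (n + n.natAbs) * g) := by
      rw [MulMemClass.coe_mul, coe_coordX_zpow, ← mul_assoc, yPow_mul, add_left_comm]

end Series

section DeligneUnique

open Polynomial

variable {M : Type*} [AddCommGroup M] [Module ℂ M] [Module ConvLaurent M]
  [IsScalarTower ℂ ConvLaurent M] {D : Connection eulerConv M}

theorem theta_mem (V : Submodule (LogOps D) M) {m : M} (hm : m ∈ V) : D.θ m ∈ V :=
  V.smul_mem (LogOps.xdx D) hm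

theorem conv_smul_mem (V : Submodule (LogOps D) M) {a : ConvLaurent} (ha : a ∈ ConvPower) {m : M}
    (hm : m ∈ V) : a • m ∈ V :=
  V.smul_mem (⟨Algebra.lsmul ℂ ℂ M a, Algebra.subset_adjoin (Or.inr ⟨a, ha, rfl⟩)⟩ :
    logDiffOps D) hm

/-- The underlying complex vector space of a `ℂ{x}⟨x∂ₓ⟩`-submodule. -/
abbrev toComplex (V : Submodule (LogOps D) M) : Submodule ℂ M := V.restrictScalars ℂ

theorem aeval_theta_mem (V : Submodule (LogOps D) M) {m : M} (hm : m ∈ V) (p : ℂ[X]) :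
    aeval D.θ p m ∈ V :=
  aeval_apply_smul_mem_of_le_comap (q := toComplex V) hm p D.θ fun _ => theta_mem V

theorem logOps_smul_mem {A : Submodule ℂ M} (hθ : ∀ m ∈ A, D.θ m ∈ A)
    (hx : ∀ a ∈ ConvPower, ∀ m ∈ A, a • m ∈ A) (P : LogOps D) {m : M} (hm : m ∈ A) :
    P • m ∈ A := by
  have hstable : ∀ P ∈ logDiffOps D, ∀ m ∈ A, P m ∈ A := by
    intro P hP
    induction hP using Algebra.adjoin_induction with
    | mem _ hP =>
      rcases hP with rfl | ⟨a, ha, rfl⟩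
      · exact hθ
      · exact hx a ha
    | algebraMap c => exact fun m hm => A.smul_mem c hm
    | add _ _ _ _ h h' => exact fun m hm => A.add_mem (h m hm) (h' m hm)
    | mul _ _ _ _ h h' => exact fun m hm => h _ (h' m hm)
  exact hstable (show logDiffOps D from P).1 (show logDiffOps D from P).2 m hm

/-- A complex subspace stable under `x∂ₓ` and `ℂ{x}`, as a `ℂ{x}⟨x∂ₓ⟩`-submodule. -/
def ofStable (A : Submodule ℂ M) (hθ : ∀ m ∈ A, D.θ m ∈ A)
    (hx : ∀ a ∈ ConvPower, ∀ m ∈ A, a • m ∈ A) : Submodule (LogOps D) M where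
  carrier := A
  add_mem' := A.add_mem
  zero_mem' := A.zero_mem
  smul_mem' P _ hm := logOps_smul_mem hθ hx P hm

variable {V V' : ℝ → Submodule (LogOps D) M}

theorem mem_filtGt (hV : Antitone V) {b : ℝ} {m : M} :
    m ∈ filtGt V b ↔ ∃ c, b < c ∧ m ∈ V c := by
  rw [filtGt, Submodule.mem_iSup_of_directed]
  · simp
  · rintro ⟨c, hc⟩ ⟨d, hd⟩
    exact ⟨⟨min c d, Set.mem_Ioi.2 (lt_min hc hd)⟩, hV (min_le_left c d), hV (min_le_right c d)⟩

/-- The real number `b` is a jump of the filtration `V`: the graded piece `gr^b_V` is nonzero. -/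
def IsJump (V : ℝ → Submodule (LogOps D) M) (b : ℝ) : Prop := ∃ m ∈ V b, m ∉ filtGt V b

theorem eq_of_add_int_eq_add_int {s t : ℝ} (hs : s ∈ Set.Ico (0 : ℝ) 1)
    (ht : t ∈ Set.Ico (0 : ℝ) 1) {k n : ℤ} (h : s + k = t + n) : s = t := by
  rw [← Int.fract_eq_self.2 hs, ← Int.fract_eq_self.2 ht, ← Int.fract_add_intCast s k, h,
    Int.fract_add_intCast]

namespace IsDeligneFiltration

theorem re_eq (hV : IsDeligneFiltration D V) {b : ℝ} {m : M} (hm : m ∈ V b) {β : ℂ}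
    (h : IsEigenvectorMod D.θ (toComplex (filtGt V b)) β m) : β.re = b := by
  refine hV.eigenvalue_re b β (Module.End.hasEigenvalue_of_hasEigenvector
    (x := Submodule.Quotient.mk (⟨m, hm⟩ : V b)) ⟨Module.End.mem_eigenspace_iff.2 ?_, fun h0 => ?_⟩)
  · exact (Submodule.Quotient.eq ((filtGt V b).submoduleOf (V b))
      (x := LogOps.xdx D • (⟨m, hm⟩ : V b)) (y := β • (⟨m, hm⟩ : V b))).2 h.sub_smul_mem
  · exact h.notMem ((Submodule.Quotient.mk_eq_zero ((filtGt V b).submoduleOf (V b))).1 h0)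

theorem exists_rootsGE (hV : IsDeligneFiltration D V) {b : ℝ} {m : M} (hm : m ∈ V b) :
    ∃ p, RootsGE b p ∧ aeval D.θ p m ∈ filtGt V b := by
  have hfin := hV.finite_gr b
  have : FiniteDimensional ℂ
      (toComplex (V b) ⧸ (toComplex (filtGt V b)).submoduleOf (toComplex (V b))) :=
    Module.Finite.equiv
      (Submodule.Quotient.restrictScalarsEquiv ℂ ((filtGt V b).submoduleOf (V b))).symm
  obtain ⟨p, hp, hpV⟩ := exists_forall_aeval_mem (A := toComplex (filtGt V b))
    (B := toComplex (V b)) (fun _ => theta_mem _) fun _ => theta_mem _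
  obtain ⟨g, hgp, hgm, hg⟩ := exists_dvd_aeval_mem_forall_isEigenvectorMod hp (hpV m hm)
  refine ⟨g, ⟨ne_zero_of_dvd_ne_zero hp hgp, fun β hβ => ?_⟩, hgm⟩
  obtain ⟨h, hh⟩ := hg β hβ
  exact (hV.re_eq (aeval_theta_mem _ hm h) hh).ge

theorem zpow_smul_mem_iff (hV : IsDeligneFiltration D V) (n : ℤ) (b : ℝ) (m : M) :
    coordX ^ n • m ∈ V (b + n) ↔ m ∈ V b := by
  induction n generalizing b m with
  | zero => simp
  | succ n ih =>
    rw [zpow_add_one₀ coordX_ne_zero, mul_comm, mul_smul, Int.cast_add, Int.cast_one, ← add_assoc,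
      hV.mul_x, ih]
  | pred n ih =>
    rw [← hV.mul_x, smul_smul, ← zpow_one_add₀ coordX_ne_zero, ← ih b m,
      Int.cast_sub, Int.cast_one, add_assoc, sub_add_cancel, add_sub_cancel]

theorem exists_smul_mem_iff (hV : IsDeligneFiltration D V) {a : ConvLaurent} (ha : a ≠ 0) :
    ∃ n : ℤ, ∀ (b : ℝ) (m : M), a • m ∈ V (b + n) ↔ m ∈ V b := by
  obtain ⟨n, u, rfl, hu, hu'⟩ := exists_eq_zpow_mul ha
  refine ⟨n, fun b m => ?_⟩
  rw [mul_smul, hV.zpow_smul_mem_iff]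
  refine ⟨fun h => ?_, conv_smul_mem _ hu⟩
  have := conv_smul_mem _ hu' h
  rwa [smul_smul, inv_mul_cancel₀ (right_ne_zero_of_mul ha), one_smul] at this

theorem smul_mem_filtGt_iff (hV : IsDeligneFiltration D V) {a : ConvLaurent} {n : ℤ}
    (ha : ∀ (b : ℝ) (m : M), a • m ∈ V (b + n) ↔ m ∈ V b) (b : ℝ) (m : M) :
    a • m ∈ filtGt V (b + n) ↔ m ∈ filtGt V b := by
  simp only [mem_filtGt hV.antitone]
  refine ⟨fun ⟨c, hc, hm⟩ => ⟨c - n, by linarith, ?_⟩,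
    fun ⟨c, hc, hm⟩ => ⟨c + n, by linarith, (ha c m).2 hm⟩⟩
  rwa [← ha, sub_add_cancel]

theorem mem_of_forall_lt (hV : IsDeligneFiltration D V) {b : ℝ} {m : M}
    (h : ∀ c < b, m ∈ V c) : m ∈ V b := by
  rw [← hV.left_continuous b, Submodule.mem_iInf]
  exact fun c => h c c.2

theorem exists_last_step (hV : IsDeligneFiltration D V) {b c : ℝ} {m : M} (hc : m ∈ V c)
    (hb : m ∉ V b) : ∃ e, c ≤ e ∧ e < b ∧ m ∈ V e ∧ m ∉ filtGt V e := by
  have hlt : ∀ e, m ∈ V e → e < b := fun e he => by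
    by_contra! h
    exact hb (hV.antitone h he)
  have hbdd : BddAbove {e | m ∈ V e} := ⟨b, fun e he => (hlt e he).le⟩
  have hmem : m ∈ V (sSup {e | m ∈ V e}) := by
    refine hV.mem_of_forall_lt fun d hd => ?_
    obtain ⟨e, he, hde⟩ := exists_lt_of_lt_csSup ⟨c, hc⟩ hd
    exact hV.antitone hde.le he
  refine ⟨sSup {e | m ∈ V e}, le_csSup hbdd hc, hlt _ hmem, hmem, fun h => ?_⟩
  obtain ⟨d, hd, hmd⟩ := (mem_filtGt hV.antitone).1 h
  exact (le_csSup hbdd hmd).not_gt hd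

-- In a linear relation, the terms of least index of the filtration cannot cancel, because the
-- indices of the terms are distinct modulo `ℤ`.
theorem linearIndependent_of_jumps (hV : IsDeligneFiltration D V) {ι : Type*} {e : ι → ℝ}
    (he : Function.Injective e) (he01 : ∀ i, e i ∈ Set.Ico (0 : ℝ) 1) {m : ι → M}
    (hm : ∀ i, m i ∈ V (e i)) (hm' : ∀ i, m i ∉ filtGt V (e i)) :
    LinearIndependent ConvLaurent m := by
  classical
  rw [linearIndependent_iff']
  intro s a hsum
  by_contra! hne
  obtain ⟨i₀, hi₀, hai₀⟩ := hne
  choose! n hn using fun (a : ConvLaurent) (ha : a ≠ 0) => hV.exists_smul_mem_iff ha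
  obtain ⟨i, hi, hmin⟩ := Finset.exists_min_image (s.filter fun i => a i ≠ 0)
    (fun i => e i + n (a i)) ⟨i₀, Finset.mem_filter.2 ⟨hi₀, hai₀⟩⟩
  obtain ⟨his, hai⟩ := Finset.mem_filter.1 hi
  refine hm' i ((hV.smul_mem_filtGt_iff (hn _ hai) (e i) (m i)).1 ?_)
  rw [← Finset.add_sum_erase s _ his] at hsum
  rw [eq_neg_of_add_eq_zero_left hsum]
  refine Submodule.neg_mem _ (Submodule.sum_mem _ fun j hj => ?_)
  obtain ⟨hji, hjs⟩ := Finset.mem_erase.1 hj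
  by_cases haj : a j = 0
  · rw [haj, zero_smul]
    exact zero_mem _
  have hne : e i + n (a i) ≠ e j + n (a j) := fun h =>
    hji (he (eq_of_add_int_eq_add_int (he01 i) (he01 j) h)).symm
  exact (mem_filtGt hV.antitone).2 ⟨e j + n (a j),
    (hmin j (Finset.mem_filter.2 ⟨hjs, haj⟩)).lt_of_ne hne, (hn _ haj _ _).2 (hm j)⟩

theorem isJump_add_int (hV : IsDeligneFiltration D V) {b : ℝ} (n : ℤ) (h : IsJump V b) :
    IsJump V (b + n) := by
  obtain ⟨m, hm, hm'⟩ := h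
  exact ⟨coordX ^ n • m, (hV.zpow_smul_mem_iff n b m).2 hm,
    mt (hV.smul_mem_filtGt_iff (hV.zpow_smul_mem_iff n) b m).1 hm'⟩

section Finite

variable [FiniteDimensional ConvLaurent M]

theorem finite_jumps_Ico_zero_one (hV : IsDeligneFiltration D V) :
    {e | e ∈ Set.Ico (0 : ℝ) 1 ∧ IsJump V e}.Finite := by
  choose m hm hm' using fun e : {e | e ∈ Set.Ico (0 : ℝ) 1 ∧ IsJump V e} => e.2.2
  rw [← Set.finite_coe_iff]
  exact (hV.linearIndependent_of_jumps Subtype.val_injective (fun e => e.2.1)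
    hm hm').finite_of_isNoetherian

theorem finite_jumps_Ico (hV : IsDeligneFiltration D V) (b c : ℝ) :
    {e | e ∈ Set.Ico b c ∧ IsJump V e}.Finite := by
  refine Set.Finite.subset ((Set.finite_Icc ⌊b⌋ ⌊c⌋).biUnion fun n _ =>
    (hV.finite_jumps_Ico_zero_one.image fun e => e + (n : ℝ))) ?_
  rintro e ⟨⟨hbe, hec⟩, hjump⟩
  refine Set.mem_biUnion (x := ⌊e⌋) ⟨Int.floor_mono hbe, Int.floor_mono hec.le⟩
    ⟨e - ⌊e⌋, ⟨⟨Int.fract_nonneg e, Int.fract_lt_one e⟩, ?_⟩, sub_add_cancel _ _⟩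
  simpa [sub_eq_add_neg] using hV.isJump_add_int (-⌊e⌋) hjump

theorem exists_rootsGE_aeval_mem (hV : IsDeligneFiltration D V) {b : ℝ} (c : ℝ) {m : M}
    (hm : m ∈ V b) : ∃ p, RootsGE b p ∧ aeval D.θ p m ∈ V c := by
  induction hN : {e | e ∈ Set.Ico b c ∧ IsJump V e}.ncard using Nat.strong_induction_on
    generalizing b m with
  | _ N ih =>
    by_cases hmc : m ∈ V c
    · exact ⟨1, rootsGE_one b, by simpa⟩
    obtain ⟨e, hbe, hec, hme, hme'⟩ := hV.exists_last_step hm hmc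
    obtain ⟨p, hp, hpm⟩ := hV.exists_rootsGE hme
    obtain ⟨d, hed, hpd⟩ := (mem_filtGt hV.antitone).1 hpm
    have hlt : {e | e ∈ Set.Ico d c ∧ IsJump V e}.ncard < N := by
      rw [← hN]
      refine Set.ncard_lt_ncard ⟨fun x hx => ⟨⟨(hbe.trans hed.le).trans hx.1.1, hx.1.2⟩, hx.2⟩,
        fun h => ?_⟩ (hV.finite_jumps_Ico b c)
      exact (h ⟨⟨hbe, hec⟩, m, hme, hme'⟩).1.1.not_gt hed
    obtain ⟨p', hp', hpm'⟩ := ih _ hlt hpd rfl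
    refine ⟨p' * p, (hp'.mono (hbe.trans hed.le)).mul (hp.mono hbe), ?_⟩
    rwa [map_mul, Module.End.mul_apply]

end Finite

theorem exists_mem (hV : IsDeligneFiltration D V) (m : M) : ∃ c, m ∈ V c := by
  have hm : m ∈ ⨆ b, V b := hV.exhaustive ▸ Submodule.mem_top
  rwa [Submodule.mem_iSup_of_directed _ hV.antitone.directed_le] at hm

theorem exists_le_of_fg (hV : IsDeligneFiltration D V) {W : Submodule (LogOps D) M} (hW : W.FG) :
    ∃ c, W ≤ V c := by
  obtain ⟨s, rfl⟩ := hW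
  choose c hc using hV.exists_mem
  obtain ⟨d, hd⟩ := (s.finite_toSet.image c).bddBelow
  exact ⟨d, Submodule.span_le.2 fun m hm => hV.antitone (hd ⟨m, hm, rfl⟩) (hc m)⟩

theorem add_int_le_add_int (hV : IsDeligneFiltration D V) (hV' : IsDeligneFiltration D V')
    {b c : ℝ} (h : V b ≤ V' c) (n : ℤ) : V (b + n) ≤ V' (c + n) := by
  intro m hm
  have hshift : m = coordX ^ n • coordX ^ (-n) • m := by
    rw [smul_smul, ← zpow_add₀ coordX_ne_zero, add_neg_cancel, zpow_zero, one_smul]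
  rw [hshift, hV.zpow_smul_mem_iff] at hm
  rw [hshift, hV'.zpow_smul_mem_iff]
  exact h hm

theorem le [FiniteDimensional ConvLaurent M] (hV : IsDeligneFiltration D V)
    (hV' : IsDeligneFiltration D V') (b : ℝ) : V b ≤ V' b := by
  obtain ⟨c, hc⟩ := hV'.exists_le_of_fg (hV.fg b)
  obtain ⟨k, hk⟩ := exists_nat_ge (b - c)
  intro m hm
  obtain ⟨p, hp, hpm⟩ := hV.exists_rootsGE_aeval_mem (b + (k : ℤ)) hm
  have hpm' : aeval D.θ p m ∈ V' b :=
    hV'.antitone (by push_cast; linarith) (hV.add_int_le_add_int hV' hc k hpm)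
  by_contra hmb
  obtain ⟨e, -, heb, hme, hme'⟩ := hV'.exists_last_step (hc hm) hmb
  obtain ⟨β, hβ, h, hh⟩ := exists_isRoot_isEigenvectorMod (A := toComplex (filtGt V' e)) hme' hp.1
    ((mem_filtGt hV'.antitone).2 ⟨b, heb, hpm'⟩)
  have hre := hV'.re_eq (aeval_theta_mem _ hme h) hh
  linarith [hp.2 β hβ]

theorem unique [FiniteDimensional ConvLaurent M] (hV : IsDeligneFiltration D V)
    (hV' : IsDeligneFiltration D V') : V = V' :=
  funext fun b => le_antisymm (hV.le hV' b) (hV'.le hV b)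

end IsDeligneFiltration

end DeligneUnique

section Lattices

open Polynomial

theorem eq_zero_of_forall_exists_eq_pow_smul {A E : Type*} [CommRing A] [IsNoetherianRing A]
    [IsLocalRing A] [AddCommGroup E] [Module A E] [Module.Finite A E] {a : A} (ha : ¬ IsUnit a)
    {m : E} (h : ∀ n : ℕ, ∃ m', m = a ^ n • m') : m = 0 := by
  have hbot := Ideal.iInf_pow_smul_eq_bot_of_isLocalRing (M := E) (Ideal.span {a})
    (mt Ideal.span_singleton_eq_top.1 ha)
  refine (Submodule.eq_bot_iff _).1 hbot m ((Submodule.mem_iInf _).2 fun n => ?_)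
  obtain ⟨m', rfl⟩ := h n
  exact Submodule.smul_mem_smul
    (Ideal.pow_mem_pow (Ideal.mem_span_singleton_self a) n) Submodule.mem_top

variable {R : Type*} [AddCommGroup R] [Module ℂ⸨X⸩ R]

theorem formal_smul_mem (L : Submodule FormalPower R) {g : ℂ⸨X⸩} (hg : g ∈ FormalPower) {m : R}
    (hm : m ∈ L) : g • m ∈ L :=
  L.smul_mem ⟨g, hg⟩ hm

/-- The lattice `y ^ n L`. -/
def shift (L : Submodule FormalPower R) (n : ℤ) : Submodule FormalPower R where
  carrier := {m | yPow (-n) • m ∈ L}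
  add_mem' h h' := by
    rw [Set.mem_ofPred_eq, smul_add]
    exact L.add_mem h h'
  zero_mem' := by rw [Set.mem_ofPred_eq, smul_zero]; exact L.zero_mem
  smul_mem' g m h := by
    rw [Set.mem_ofPred_eq, Subring.smul_def, smul_comm]
    exact formal_smul_mem L g.2 h

variable {L L' : Submodule FormalPower R}

theorem mem_shift {n : ℤ} {m : R} : m ∈ shift L n ↔ yPow (-n) • m ∈ L := Iff.rfl

theorem shift_zero : shift L 0 = L := by
  ext m
  rw [mem_shift, neg_zero, yPow_zero, one_smul]

theorem yPow_smul_mem_shift {k n : ℤ} {m : R} : yPow k • m ∈ shift L n ↔ m ∈ shift L (n - k) := by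
  rw [mem_shift, mem_shift, smul_smul, yPow_mul]
  ring_nf

theorem yPow_smul_mem_shift_self {n : ℤ} {m : R} : yPow n • m ∈ shift L n ↔ m ∈ L := by
  rw [yPow_smul_mem_shift, sub_self, shift_zero]

theorem shift_shift (n k : ℤ) : shift (shift L n) k = shift L (n + k) := by
  ext m
  rw [mem_shift, yPow_smul_mem_shift, sub_neg_eq_add]

theorem shift_anti {n n' : ℤ} (h : n ≤ n') : shift L n' ≤ shift L n := fun m hm => by
  have hmem := formal_smul_mem L (yPow_mem (sub_nonneg.2 h)) (mem_shift.1 hm)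
  rwa [smul_smul, yPow_mul, sub_add_eq_add_sub, add_neg_cancel, zero_sub] at hmem

theorem shift_mono (h : L ≤ L') (n : ℤ) : shift L n ≤ shift L' n := fun _ hm => h hm

theorem mem_shift_one_iff {m : R} : m ∈ shift L 1 ↔ ∃ m' ∈ L, m = yPow 1 • m' := by
  constructor
  · intro h
    exact ⟨_, h, by rw [smul_smul, yPow_mul_neg, one_smul]⟩
  · rintro ⟨m', hm', rfl⟩
    exact yPow_smul_mem_shift_self.2 hm'

theorem exists_mem_shift (hL : Submodule.span ℂ⸨X⸩ (L : Set R) = ⊤) (m : R) :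
    ∃ T : ℕ, m ∈ shift L (-T) := by
  have hm : m ∈ Submodule.span ℂ⸨X⸩ (L : Set R) := hL ▸ Submodule.mem_top
  induction hm using Submodule.span_induction with
  | mem m hm => exact ⟨0, by simpa [shift_zero] using hm⟩
  | zero => exact ⟨0, zero_mem _⟩
  | add m m' _ _ h h' =>
    obtain ⟨T, hT⟩ := h
    obtain ⟨T', hT'⟩ := h'
    exact ⟨max T T', add_mem (shift_anti (by simp) hT) (shift_anti (by simp) hT')⟩
  | smul g m _ h =>
    obtain ⟨T, hT⟩ := h
    refine ⟨g.order.natAbs + T, ?_⟩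
    have hmem := formal_smul_mem _ (yPow_mul_mem (n := g.order.natAbs) (f := g) (by omega)) hT
    rw [mul_smul, yPow_smul_mem_shift] at hmem
    convert hmem using 2
    push_cast
    ring

theorem exists_le_shift (hL : Submodule.span ℂ⸨X⸩ (L : Set R) = ⊤) (hL' : L'.FG) :
    ∃ T : ℕ, L' ≤ shift L (-T) := by
  obtain ⟨s, rfl⟩ := hL'
  choose T hT using exists_mem_shift hL
  exact ⟨s.sup T, Submodule.span_le.2 fun m hm =>
    shift_anti (neg_le_neg (by exact_mod_cast Finset.le_sup hm)) (hT m)⟩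

theorem not_isUnit_yPow_one : ¬ IsUnit (⟨yPow 1, yPow_mem zero_le_one⟩ : FormalPower) := by
  rw [isUnit_iff_exists_inv]
  rintro ⟨u, hu⟩
  have hinv : (u : ℂ⸨X⸩) = yPow (-1) :=
    mul_left_cancel₀ (yPow_ne_zero 1) ((congrArg Subtype.val hu).trans (yPow_mul_neg 1).symm)
  have horder := mem_formalPower_iff_order.1 u.2
  rw [hinv, HahnSeries.order_single one_ne_zero] at horder
  omega

theorem eq_zero_of_forall_mem_shift (hL : L.FG) {m : R} (h : ∀ n : ℕ, m ∈ shift L n) : m = 0 := by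
  have hmL : m ∈ L := by simpa [shift_zero] using h 0
  have : Module.Finite FormalPower L := Module.Finite.iff_fg.2 hL
  have : IsLocalRing FormalPower := (LaurentSeries.powerSeriesEquivSubring ℂ).isLocalRing
  have hzero : (⟨m, hmL⟩ : L) = 0 :=
    eq_zero_of_forall_exists_eq_pow_smul (m := (⟨m, hmL⟩ : L)) not_isUnit_yPow_one fun n => by
      refine ⟨⟨yPow (-n) • m, mem_shift.1 (h n)⟩, Subtype.ext ?_⟩
      rw [Submodule.coe_smul, Subring.smul_def, SubmonoidClass.coe_pow, HahnSeries.single_pow,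
        one_pow, nsmul_one, smul_smul, yPow_mul_neg, one_smul]
  exact congrArg Subtype.val hzero

variable [Module ℂ R] [IsScalarTower ℂ ℂ⸨X⸩ R]

/-- The complex vector space underlying a `ℂ[[y]]`-submodule. -/
def latticeSpace (L : Submodule FormalPower R) : Submodule ℂ R where
  carrier := L
  add_mem' := L.add_mem
  zero_mem' := L.zero_mem
  smul_mem' c m hm := by
    rw [← algebraMap_smul ℂ⸨X⸩ c m]
    exact formal_smul_mem L (algebraMap_mem_formalPower c) hm

theorem mem_latticeSpace {m : R} : m ∈ latticeSpace L ↔ m ∈ L := Iff.rfl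

theorem complex_smul_mem (L : Submodule FormalPower R) (c : ℂ) {m : R} (hm : m ∈ L) : c • m ∈ L :=
  (latticeSpace L).smul_mem c hm

theorem finiteDimensional_latticeSpace_quotient (hL : L.FG) :
    FiniteDimensional ℂ
      (latticeSpace L ⧸ (latticeSpace (shift L 1)).submoduleOf (latticeSpace L)) := by
  obtain ⟨s, hs⟩ := hL
  have : FiniteDimensional ℂ (Submodule.span ℂ (s : Set R)) := FiniteDimensional.span_finset ℂ s
  refine finiteDimensional_quotient_of_le_sup (F := Submodule.span ℂ s) fun m hm => ?_
  rw [mem_latticeSpace, ← hs] at hm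
  induction hm using Submodule.span_induction with
  | mem m hm => exact Submodule.mem_sup_left (Submodule.subset_span hm)
  | zero => exact zero_mem _
  | add m m' _ _ h h' => exact add_mem h h'
  | smul g m hm h =>
    obtain ⟨c, g', hg', hg⟩ := exists_eq_algebraMap_add_yPow_mul g.2
    rw [Subring.smul_def, hg, add_smul, algebraMap_smul, mul_smul]
    exact add_mem (Submodule.smul_mem _ _ h) (Submodule.mem_sup_right
      (mem_shift_one_iff.2 ⟨_, formal_smul_mem L hg' (hs ▸ hm), rfl⟩))

theorem theta_yPow_smul (D : Connection eulerFormal R) (n : ℤ) (m : R) :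
    D.θ (yPow n • m) = yPow n • D.θ m + (n : ℂ) • yPow n • m := by
  rw [D.leibniz, eulerFormal_yPow, smul_assoc, add_comm]

variable {D : Connection eulerFormal R}

theorem theta_mem_shift (hL : ∀ m ∈ L, D.θ m ∈ L) {n : ℤ} {m : R} (hm : m ∈ shift L n) :
    D.θ m ∈ shift L n := by
  have hθ := hL _ hm
  rw [theta_yPow_smul] at hθ
  exact (Submodule.add_mem_iff_left L (complex_smul_mem L _ hm)).1 hθ

theorem aeval_mem_lattice (hL : ∀ m ∈ L, D.θ m ∈ L) (p : ℂ[X]) {m : R} (hm : m ∈ L) :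
    aeval D.θ p m ∈ L :=
  aeval_apply_smul_mem_of_le_comap (q := latticeSpace L) hm p D.θ hL

theorem aeval_mem_shift (hL : ∀ m ∈ L, D.θ m ∈ L) {n : ℤ} (p : ℂ[X]) {m : R}
    (hm : m ∈ shift L n) : aeval D.θ p m ∈ shift L n :=
  aeval_mem_lattice (fun _ => theta_mem_shift hL) p hm

/-- The eigenvalues of the residue of `D` on the lattice `L`, that is of `y∂_y` on `L / y L`. -/
def IsResidue (D : Connection eulerFormal R) (L : Submodule FormalPower R) (β : ℂ) : Prop :=
  ∃ m ∈ L, IsEigenvectorMod D.θ (latticeSpace (shift L 1)) β m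

theorem IsResidue.of_shift {n : ℤ} {β : ℂ} (h : IsResidue D (shift L n) β) :
    IsResidue D L (β - n) := by
  obtain ⟨m, hm, hm', hβ⟩ := h
  have hshift : ∀ v, yPow (-n) • v ∈ shift L 1 ↔ v ∈ shift (shift L n) 1 := fun v => by
    rw [yPow_smul_mem_shift, sub_neg_eq_add, shift_shift, add_comm]
  refine ⟨yPow (-n) • m, hm, mt (hshift m).1 hm', ?_⟩
  have hθ : D.θ (yPow (-n) • m) - (β - n) • yPow (-n) • m = yPow (-n) • (D.θ m - β • m) := by
    rw [theta_yPow_smul, smul_sub, smul_comm _ β]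
    push_cast
    module
  rw [hθ]
  exact (hshift _).2 hβ

theorem exists_residue_bound (hL : IsLogLattice D L) :
    ∃ B : ℕ, ∀ β, IsResidue D L β → |β.re| ≤ B := by
  have hstable : ∀ m ∈ latticeSpace (shift L 1), D.θ m ∈ latticeSpace (shift L 1) := fun _ =>
    theta_mem_shift hL.stable
  have := finiteDimensional_latticeSpace_quotient hL.fg
  obtain ⟨p, hp, hpL⟩ := exists_forall_aeval_mem (B := latticeSpace L) hstable hL.stable
  obtain ⟨B, hB⟩ := exists_nat_ge (∑ β ∈ p.roots.toFinset, |β.re|)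
  refine ⟨B, fun β ⟨m, hm, hmβ⟩ => le_trans ?_ hB⟩
  exact Finset.single_le_sum (f := fun β : ℂ => |β.re|) (fun _ _ => abs_nonneg _)
    (Multiset.mem_toFinset.2 ((mem_roots hp).2 (hmβ.isRoot hstable (hpL m hm))))

theorem isLogLattice_shift (hL : IsLogLattice D L) (n : ℤ) : IsLogLattice D (shift L n) where
  fg := by
    have hmap :
        shift L n = L.map ((LinearMap.lsmul ℂ⸨X⸩ R (yPow n)).restrictScalars FormalPower) := by
      refine le_antisymm (fun m hm => ⟨_, hm, by simp [smul_smul]⟩) ?_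
      rintro _ ⟨m, hm, rfl⟩
      exact yPow_smul_mem_shift_self.2 hm
    rw [hmap]
    exact hL.fg.map _
  span_eq_top := by
    rw [eq_top_iff, ← hL.span_eq_top, Submodule.span_le]
    intro m hm
    have hshift : yPow n • m ∈ shift L n := yPow_smul_mem_shift_self.2 hm
    have hspan := Submodule.smul_mem _ (yPow (-n)) (Submodule.subset_span (R := ℂ⸨X⸩) hshift)
    rwa [smul_smul, yPow_neg_mul, one_smul] at hspan
  stable _ hm := theta_mem_shift hL.stable hm

end Lattices

section DeligneLattices

open Polynomial

variable {R : Type*} [AddCommGroup R] [Module ℂ R] [Module ℂ⸨X⸩ R]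
  {R' : Type*} [AddCommGroup R'] [Module ℂ R'] [Module ℂ⸨X⸩ R'] [IsScalarTower ℂ ℂ⸨X⸩ R']
  {D : Connection eulerFormal R} {D' : Connection eulerFormal R'}
  {L : Submodule FormalPower R} {L₁ : Submodule FormalPower R'} {ζ : ℂˣ} {χ : ℂ⸨X⸩}

theorem rotateFormal_yPow_smul_mem_iff {n : ℤ} {m : R'} :
    rotateFormal ζ (yPow n) • m ∈ L₁ ↔ yPow n • m ∈ L₁ := by
  rw [rotateFormal_yPow, smul_assoc]
  exact (latticeSpace L₁).smul_mem_iff (Units.ne_zero _)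

theorem exists_map_mem_shift (hL : L.FG) (hL₁ : Submodule.span ℂ⸨X⸩ (L₁ : Set R') = ⊤)
    (f : R →ₗ[ℂ] R') (hsmul : ∀ (g : ℂ⸨X⸩) m, f (g • m) = rotateFormal ζ g • f m) :
    ∃ T : ℕ, ∀ (n : ℤ), ∀ m ∈ shift L n, f m ∈ shift L₁ (n - T) := by
  obtain ⟨s, hs⟩ := hL
  choose T hT using exists_mem_shift hL₁
  have hmap : ∀ m ∈ L, f m ∈ shift L₁ (-(s.sup fun m => T (f m) : ℕ)) := by
    intro m hm
    rw [← hs] at hm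
    induction hm using Submodule.span_induction with
    | mem m hm =>
      refine shift_anti (neg_le_neg ?_) (hT (f m))
      exact_mod_cast Finset.le_sup (f := fun m => T (f m)) hm
    | zero => rw [map_zero]; exact zero_mem _
    | add m m' _ _ h h' => rw [map_add]; exact add_mem h h'
    | smul g m _ h =>
      rw [Subring.smul_def, hsmul]
      exact formal_smul_mem _ (rotateFormal_mem ζ g.2) h
  refine ⟨s.sup fun m => T (f m), fun n m hm => ?_⟩
  have hfm := hmap _ (mem_shift.1 hm)
  rwa [hsmul, rotateFormal_yPow_smul_mem_iff, yPow_smul_mem_shift, sub_neg_eq_add,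
    neg_add_eq_sub] at hfm

theorem eq_zero_of_twist (hL : IsLogLattice D L) (hL₁ : IsLogLattice D' L₁) (f : R →ₗ[ℂ] R')
    (hsmul : ∀ (g : ℂ⸨X⸩) m, f (g • m) = rotateFormal ζ g • f m) (hχ : χ.order < 0)
    (hf : ∀ m, f (D.θ m) - D'.θ (f m) = χ • f m) : f = 0 := by
  have hχ0 : χ ≠ 0 := by
    rintro rfl
    simp at hχ
  obtain ⟨T, hT⟩ := exists_map_mem_shift hL.fg hL₁.span_eq_top f hsmul
  -- Since `χ⁻¹` is divisible by `y`, the relation `hf` improves any bound on `f(L)` by one step.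
  have hdeep : ∀ (k : ℕ), ∀ m ∈ L, f m ∈ shift L₁ (k - T) := by
    intro k
    induction k with
    | zero => exact fun m hm => hT 0 m (by rwa [shift_zero])
    | succ k ih =>
      intro m hm
      have htwist := sub_mem (ih _ (hL.stable m hm)) (theta_mem_shift hL₁.stable (ih m hm))
      rw [hf] at htwist
      have hmem := formal_smul_mem _ (yPow_neg_one_mul_inv_mem hχ) htwist
      rw [smul_smul, mul_assoc, inv_mul_cancel₀ hχ0, mul_one, yPow_smul_mem_shift] at hmem
      convert hmem using 2
      push_cast
      ring
  have hzero : ∀ m ∈ L, f m = 0 := fun m hm => eq_zero_of_forall_mem_shift hL₁.fg fun n => by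
    have hmem := hdeep (n + T) m hm
    push_cast at hmem
    rwa [add_sub_cancel_right] at hmem
  ext m
  obtain ⟨k, hk⟩ := exists_mem_shift hL.span_eq_top m
  have hfm := hzero _ (mem_shift.1 hk)
  rw [hsmul] at hfm
  exact (smul_eq_zero.1 hfm).resolve_left ((_root_.map_ne_zero _).2 (yPow_ne_zero _))

variable [IsScalarTower ℂ ℂ⸨X⸩ R] {L' : Submodule FormalPower R}

theorem isDeligneLattice_iff {b : ℝ} : IsDeligneLattice D b L ↔
    IsLogLattice D L ∧ ∀ β, IsResidue D L β → b ≤ β.re ∧ β.re < b + 1 := by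
  have hresidue : ∀ β m, IsEigenvectorMod D.θ (latticeSpace (shift L 1)) β m ↔
      (¬ ∃ m' ∈ L, m = yPow 1 • m') ∧ ∃ m' ∈ L, D.θ m - β • m = yPow 1 • m' := fun β m => by
    rw [← mem_shift_one_iff, ← mem_shift_one_iff]
    exact ⟨fun h => ⟨h.1, h.2⟩, fun h => ⟨h.1, h.2⟩⟩
  constructor
  · rintro h
    refine ⟨h.toIsLogLattice, fun β ⟨m, hm, hβ⟩ => ?_⟩
    exact h.residue_re β m hm ((hresidue β m).1 hβ).1 ((hresidue β m).1 hβ).2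
  · rintro ⟨h, hre⟩
    exact ⟨h, fun β m hm hnot hβ => hre β ⟨m, hm, (hresidue β m).2 ⟨hnot, hβ⟩⟩⟩

theorem aeval_yPow_smul (D : Connection eulerFormal R) (n : ℤ) (p : ℂ[X]) (m : R) :
    aeval D.θ (p.comp (X - C (n : ℂ))) (yPow n • m) = yPow n • aeval D.θ p m :=
  aeval_comp_X_sub_C_apply (f := Algebra.lsmul ℂ ℂ R (yPow n)) (theta_yPow_smul D n) p m

/-- The elements whose class modulo `y ^ N L` is annihilated by a polynomial in `y∂_y` whose roots
have real part at least `b`. -/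
def regularPartMod (hL : IsLogLattice D L) (b : ℝ) (N : ℕ) : Submodule ℂ R where
  carrier := {m | ∃ p, RootsGE b p ∧ aeval D.θ p m ∈ shift L N}
  zero_mem' := ⟨1, rootsGE_one b, by rw [map_zero]; exact zero_mem _⟩
  add_mem' {m m'} := by
    rintro ⟨p, hp, hm⟩ ⟨p', hp', hm'⟩
    refine ⟨p' * p, hp'.mul hp, ?_⟩
    rw [map_add]
    refine add_mem ?_ ?_
    · rw [map_mul, Module.End.mul_apply]
      exact aeval_mem_shift hL.stable p' hm
    · rw [mul_comm, map_mul, Module.End.mul_apply]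
      exact aeval_mem_shift hL.stable p hm'
  smul_mem' c m := by
    rintro ⟨p, hp, hm⟩
    refine ⟨p, hp, ?_⟩
    rw [map_smul]
    exact complex_smul_mem _ c hm

theorem shift_le_regularPartMod (hL : IsLogLattice D L) (b : ℝ) {N : ℕ} {m : R}
    (hm : m ∈ shift L N) : m ∈ regularPartMod hL b N :=
  ⟨1, rootsGE_one b, by rwa [map_one, Module.End.one_apply]⟩

theorem yPow_one_smul_mem_regularPartMod (hL : IsLogLattice D L) {b : ℝ} {N : ℕ} {m : R}
    (hm : m ∈ regularPartMod hL b N) : yPow 1 • m ∈ regularPartMod hL b N := by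
  obtain ⟨p, hp, hpm⟩ := hm
  refine ⟨p.comp (X - C ((1 : ℤ) : ℂ)), (hp.comp_X_sub_C _).mono (by simp), ?_⟩
  rw [aeval_yPow_smul]
  exact formal_smul_mem _ (yPow_mem zero_le_one) hpm

-- A finite expansion of `g` suffices, its remainder being absorbed in `y ^ N L`.
theorem formal_smul_mem_regularPartMod (hL : IsLogLattice D L) {b : ℝ} {N : ℕ} {g : ℂ⸨X⸩}
    (hg : g ∈ FormalPower) {m : R} (hm : m ∈ regularPartMod hL b N) :
    g • m ∈ regularPartMod hL b N := by
  have hinduction : ∀ T : ℕ, ∀ g ∈ FormalPower, ∀ m ∈ regularPartMod hL b N,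
      m ∈ shift L (N - T) → g • m ∈ regularPartMod hL b N := by
    intro T
    induction T with
    | zero =>
      exact fun g hg m _ hm =>
        shift_le_regularPartMod hL b (formal_smul_mem _ hg (by simpa using hm))
    | succ T ih =>
      intro g hg m hm hmT
      obtain ⟨c, g', hg', rfl⟩ := exists_eq_algebraMap_add_yPow_mul hg
      have hmT' : yPow 1 • m ∈ shift L (N - T) := by
        rw [yPow_smul_mem_shift]
        convert hmT using 2
        push_cast
        ring
      rw [add_smul, algebraMap_smul, mul_comm, mul_smul]
      exact add_mem (Submodule.smul_mem _ c hm)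
        (ih g' hg' _ (yPow_one_smul_mem_regularPartMod hL hm) hmT')
  obtain ⟨T, hT⟩ := exists_mem_shift hL.span_eq_top m
  exact hinduction (T + N) g hg m hm (by convert hT using 2; push_cast; ring)

/-- The elements which are sent arbitrarily deep in the lattice `L` by polynomials in `y∂_y` whose
roots have real part at least `b`. It does not depend on `L`, and it turns out to be the Deligne
lattice of index `b`. -/
def regularPart (hL : IsLogLattice D L) (b : ℝ) : Submodule FormalPower R where
  carrier := {m | ∀ N : ℕ, m ∈ regularPartMod hL b N}
  zero_mem' _ := zero_mem _
  add_mem' h h' N := add_mem (h N) (h' N)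
  smul_mem' g _ h N := formal_smul_mem_regularPartMod hL g.2 (h N)

theorem regularPart_stable (hL : IsLogLattice D L) (b : ℝ) {m : R} (hm : m ∈ regularPart hL b) :
    D.θ m ∈ regularPart hL b := fun N => by
  obtain ⟨p, hp, hpm⟩ := hm N
  refine ⟨p, hp, ?_⟩
  rw [aeval_apply_of_comm (f := D.θ) fun _ => rfl]
  exact theta_mem_shift hL.stable hpm

theorem regularPart_antitone (hL : IsLogLattice D L) : Antitone (regularPart hL) :=
  fun _ _ hbc _ hm N => by
    obtain ⟨p, hp, h⟩ := hm N
    exact ⟨p, hp.mono hbc, h⟩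

theorem yPow_smul_mem_regularPart (hL : IsLogLattice D L) (n : ℤ) (b : ℝ) (m : R) :
    yPow n • m ∈ regularPart hL (b + n) ↔ m ∈ regularPart hL b := by
  have hforward : ∀ (n : ℤ) (b : ℝ) (m : R), m ∈ regularPart hL b →
      yPow n • m ∈ regularPart hL (b + n) := by
    intro n b m hm N
    obtain ⟨p, hp, h⟩ := hm (N + n.natAbs)
    refine ⟨p.comp (X - C (n : ℂ)), by simpa using hp.comp_X_sub_C n, ?_⟩
    rw [aeval_yPow_smul, yPow_smul_mem_shift]
    exact shift_anti (by omega) h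
  refine ⟨fun h => ?_, hforward n b m⟩
  have hback := hforward (-n) _ _ h
  rwa [smul_smul, yPow_neg_mul, one_smul, Int.cast_neg, add_neg_cancel_right] at hback

theorem mem_regularPart_of_forall_lt (hL : IsLogLattice D L) {b : ℝ} {m : R}
    (h : ∀ c < b, m ∈ regularPart hL c) : m ∈ regularPart hL b := by
  intro N
  obtain ⟨p, hp, hpm⟩ := h (b - 1) (by linarith) N
  obtain ⟨g, hgp, hgm, heigen⟩ :=
    exists_dvd_aeval_mem_forall_isEigenvectorMod (A := latticeSpace (shift L N)) hp.1 hpm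
  refine ⟨g, ⟨ne_zero_of_dvd_ne_zero hp.1 hgp, fun β hβ => le_of_forall_lt_imp_le_of_dense
    fun c hc => ?_⟩, hgm⟩
  obtain ⟨p', hp', hpm'⟩ := h c hc N
  obtain ⟨r, hr⟩ := heigen β hβ
  refine hp'.2 β (hr.isRoot (fun _ => theta_mem_shift hL.stable) ?_)
  rw [← Module.End.mul_apply, ← map_mul, mul_comm, map_mul, Module.End.mul_apply]
  exact aeval_mem_shift hL.stable r hpm'

theorem exists_rootsGE_aeval_mem_shift_one (hL : IsLogLattice D L) {b : ℝ}
    (h : ∀ β, IsResidue D L β → b ≤ β.re) {m : R} (hm : m ∈ L) :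
    ∃ p, RootsGE b p ∧ aeval D.θ p m ∈ shift L 1 := by
  have := finiteDimensional_latticeSpace_quotient hL.fg
  obtain ⟨p, hp, hpL⟩ := exists_forall_aeval_mem (B := latticeSpace L)
    (A := latticeSpace (shift L 1)) (fun _ => theta_mem_shift hL.stable) hL.stable
  obtain ⟨g, hgp, hgm, heigen⟩ := exists_dvd_aeval_mem_forall_isEigenvectorMod hp (hpL m hm)
  refine ⟨g, ⟨ne_zero_of_dvd_ne_zero hp hgp, fun β hβ => h β ?_⟩, hgm⟩
  obtain ⟨r, hr⟩ := heigen β hβ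
  exact ⟨_, aeval_mem_lattice hL.stable r hm, hr⟩

theorem le_regularPart (hL : IsLogLattice D L) {b : ℝ}
    (h : ∀ β, IsResidue D L β → b ≤ β.re) : L ≤ regularPart hL b := by
  intro m hm N
  induction N with
  | zero => exact shift_le_regularPartMod hL b (by simpa [shift_zero] using hm)
  | succ N ih =>
    obtain ⟨p, hp, hpm⟩ := ih
    obtain ⟨p', hp', hpm'⟩ := exists_rootsGE_aeval_mem_shift_one hL h hpm
    refine ⟨p'.comp (X - C ((N : ℤ) : ℂ)) * p,
      ((hp'.comp_X_sub_C _).mono (by simp)).mul hp, ?_⟩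
    have hdvd : aeval D.θ p m = yPow N • yPow (-N) • aeval D.θ p m := by
      rw [smul_smul, yPow_mul_neg, one_smul]
    rw [map_mul, Module.End.mul_apply, hdvd, aeval_yPow_smul, yPow_smul_mem_shift]
    convert hpm' using 2
    push_cast
    ring

theorem regularPart_le (hL : IsLogLattice D L) {b : ℝ}
    (h : ∀ β, IsResidue D L β → β.re < b + 1) : regularPart hL b ≤ L := by
  have hinduction : ∀ k : ℕ, ∀ m ∈ regularPart hL b, m ∈ shift L (-k) → m ∈ L := by
    intro k
    induction k with
    | zero => intro m _ hm; simpa [shift_zero] using hm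
    | succ k ih =>
      intro m hm hmk
      refine ih m hm ?_
      by_contra hnot
      obtain ⟨p, hp, hpm⟩ := hm 0
      obtain ⟨β, hβ, r, hr⟩ := exists_isRoot_isEigenvectorMod
        (A := latticeSpace (shift L (-k))) hnot hp.1 (shift_anti (by simp) hpm)
      have hshift : shift (shift L (-(k + 1 : ℕ))) 1 = shift L (-k) := by
        rw [shift_shift]
        congr 1
        push_cast
        ring
      have hresidue : IsResidue D (shift L (-(k + 1 : ℕ))) β :=
        ⟨_, aeval_mem_shift hL.stable r hmk, by rwa [hshift]⟩
      have hlt := h _ hresidue.of_shift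
      have hge := hp.2 β hβ
      push_cast [Complex.sub_re, Complex.neg_re, Complex.add_re, Complex.natCast_re,
        Complex.one_re] at hlt
      linarith [k.cast_nonneg (α := ℝ)]
  intro m hm
  obtain ⟨T, hT⟩ := exists_mem_shift hL.span_eq_top m
  exact hinduction T m hm hT

theorem map_mem_regularPart (hL : IsLogLattice D L) (hL₁ : IsLogLattice D' L₁) (f : R →ₗ[ℂ] R')
    (hf : ∀ m, D'.θ (f m) = f (D.θ m)) (T : ℕ)
    (hT : ∀ (n : ℤ), ∀ m ∈ shift L n, f m ∈ shift L₁ (n - T)) {b : ℝ} {m : R}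
    (hm : m ∈ regularPart hL b) : f m ∈ regularPart hL₁ b := by
  intro N
  obtain ⟨p, hp, hpm⟩ := hm (N + T)
  refine ⟨p, hp, ?_⟩
  rw [aeval_apply_of_comm hf]
  have hmem := hT _ _ hpm
  push_cast at hmem
  rwa [add_sub_cancel_right] at hmem

theorem regularPart_le_regularPart (hL : IsLogLattice D L) (hL' : IsLogLattice D L') (b : ℝ) :
    regularPart hL b ≤ regularPart hL' b := by
  obtain ⟨T, hT⟩ := exists_le_shift hL'.span_eq_top hL.fg
  intro m hm
  refine map_mem_regularPart hL hL' LinearMap.id (fun _ => rfl) T (fun n m hm => ?_) hm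
  have hmem := shift_mono hT n hm
  rwa [shift_shift, neg_add_eq_sub] at hmem

theorem regularPart_eq (hL : IsLogLattice D L) (hL' : IsLogLattice D L') (b : ℝ) :
    regularPart hL b = regularPart hL' b :=
  le_antisymm (regularPart_le_regularPart hL hL' b) (regularPart_le_regularPart hL' hL b)

theorem exists_shift_le_regularPart (hL : IsLogLattice D L) (b : ℝ) :
    ∃ T : ℕ, shift L T ≤ regularPart hL b := by
  obtain ⟨B, hB⟩ := exists_residue_bound hL
  obtain ⟨T, hT⟩ := exists_nat_ge (b + B)
  refine ⟨T, ?_⟩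
  rw [regularPart_eq hL (isLogLattice_shift hL T)]
  refine le_regularPart _ fun β hβ => ?_
  have hre := neg_le_of_abs_le (hB _ hβ.of_shift)
  rw [Complex.sub_re, Complex.intCast_re, Int.cast_natCast] at hre
  linarith

theorem exists_regularPart_le_shift (hL : IsLogLattice D L) (b : ℝ) :
    ∃ T : ℕ, regularPart hL b ≤ shift L (-T) := by
  obtain ⟨B, hB⟩ := exists_residue_bound hL
  obtain ⟨T, hT⟩ := exists_nat_gt (B - b)
  refine ⟨T, ?_⟩
  rw [regularPart_eq hL (isLogLattice_shift hL (-T))]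
  refine regularPart_le _ fun β hβ => ?_
  have hre := le_of_abs_le (hB _ hβ.of_shift)
  rw [Complex.sub_re, Complex.intCast_re, Int.cast_neg, Int.cast_natCast] at hre
  linarith

theorem isLogLattice_regularPart (hL : IsLogLattice D L) (b : ℝ) :
    IsLogLattice D (regularPart hL b) where
  fg := by
    obtain ⟨T, hT⟩ := exists_regularPart_le_shift hL b
    exact (isLogLattice_shift hL (-T)).fg.of_le hT
  span_eq_top := by
    obtain ⟨T, hT⟩ := exists_shift_le_regularPart hL b
    rw [eq_top_iff, ← (isLogLattice_shift hL T).span_eq_top]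
    exact Submodule.span_mono hT
  stable _ hm := regularPart_stable hL b hm

theorem shift_regularPart (hL : IsLogLattice D L) (b : ℝ) (n : ℤ) :
    shift (regularPart hL b) n = regularPart hL (b + n) := by
  ext m
  rw [mem_shift, ← yPow_smul_mem_regularPart hL (-n) (b + n)]
  simp

theorem mem_regularPart_of_re_lt (hL : IsLogLattice D L) {b c : ℝ} {m : R} {β : ℂ}
    (hm : m ∈ regularPart hL b) (hmβ : D.θ m - β • m ∈ regularPart hL c) (hβ : β.re < b) :
    m ∈ regularPart hL c := by
  obtain ⟨T, hT⟩ := exists_shift_le_regularPart hL c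
  obtain ⟨p, hp, hpm⟩ := hm T
  by_contra hnot
  have hm' : IsEigenvectorMod D.θ (latticeSpace (regularPart hL c)) β m := ⟨hnot, hmβ⟩
  exact (hp.2 β (hm'.isRoot (fun _ => regularPart_stable hL c) (hT hpm))).not_gt hβ

theorem mem_regularPart_of_re_ge (hL : IsLogLattice D L) {c : ℝ} {m : R} {β : ℂ}
    (hmβ : D.θ m - β • m ∈ regularPart hL c) (hβ : c ≤ β.re) : m ∈ regularPart hL c := by
  intro N
  obtain ⟨p, hp, hpm⟩ := hmβ N
  refine ⟨p * (X - C β), hp.mul (rootsGE_X_sub_C hβ), ?_⟩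
  rw [map_mul, Module.End.mul_apply]
  simpa using hpm

theorem deligneLattice_eq (hL : IsLogLattice D L) (b : ℝ) :
    deligneLattice D b = regularPart hL b := by
  refine le_antisymm (sSup_le fun L' hL' => ?_) (le_sSup ?_)
  · obtain ⟨h, hr⟩ := isDeligneLattice_iff.1 hL'
    rw [regularPart_eq hL h]
    exact le_regularPart h fun β hβ => (hr β hβ).1
  · refine isDeligneLattice_iff.2 ⟨isLogLattice_regularPart hL b, ?_⟩
    rintro β ⟨m, hm, hm', hβ⟩
    rw [mem_latticeSpace, shift_regularPart, Int.cast_one] at hm' hβ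
    constructor
    · by_contra hlt
      exact hm' (mem_regularPart_of_re_lt hL hm hβ (not_le.1 hlt))
    · by_contra hge
      exact hm' (mem_regularPart_of_re_ge hL hβ (not_lt.1 hge))

theorem isLogLattice_deligneLattice (hD : IsRegularSingular D) (b : ℝ) :
    IsLogLattice D (deligneLattice D b) := by
  obtain ⟨L, hL⟩ := hD
  rw [deligneLattice_eq hL]
  exact isLogLattice_regularPart hL b

theorem deligneLattice_antitone (hD : IsRegularSingular D) : Antitone (deligneLattice D) := by
  obtain ⟨L, hL⟩ := hD
  intro b c h
  rw [deligneLattice_eq hL, deligneLattice_eq hL]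
  exact regularPart_antitone hL h

theorem yPow_smul_mem_deligneLattice (hD : IsRegularSingular D) (n : ℤ) (b : ℝ) (m : R) :
    yPow n • m ∈ deligneLattice D (b + n) ↔ m ∈ deligneLattice D b := by
  obtain ⟨L, hL⟩ := hD
  rw [deligneLattice_eq hL, deligneLattice_eq hL]
  exact yPow_smul_mem_regularPart hL n b m

theorem shift_deligneLattice (hD : IsRegularSingular D) (b : ℝ) (n : ℤ) :
    shift (deligneLattice D b) n = deligneLattice D (b + n) := by
  obtain ⟨L, hL⟩ := hD
  rw [deligneLattice_eq hL, deligneLattice_eq hL, shift_regularPart]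

theorem exists_mem_deligneLattice (hD : IsRegularSingular D) (m : R) :
    ∃ b, m ∈ deligneLattice D b := by
  obtain ⟨T, hT⟩ := exists_mem_shift (isLogLattice_deligneLattice hD 0).span_eq_top m
  rw [shift_deligneLattice hD] at hT
  exact ⟨_, hT⟩

theorem mem_deligneLattice_of_forall_lt (hD : IsRegularSingular D) {b : ℝ} {m : R}
    (h : ∀ c < b, m ∈ deligneLattice D c) : m ∈ deligneLattice D b := by
  obtain ⟨L, hL⟩ := hD
  rw [deligneLattice_eq hL]
  refine mem_regularPart_of_forall_lt hL fun c hc => ?_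
  rw [← deligneLattice_eq hL]
  exact h c hc

theorem exists_gt_mem_deligneLattice_of_re_ne (hD : IsRegularSingular D) {b c : ℝ} (hbc : b < c)
    {m : R} {β : ℂ} (hm : m ∈ deligneLattice D b) (hβ : D.θ m - β • m ∈ deligneLattice D c)
    (hne : β.re ≠ b) : ∃ d, b < d ∧ m ∈ deligneLattice D d := by
  obtain ⟨L, hL⟩ := hD
  simp only [deligneLattice_eq hL] at *
  rcases lt_or_gt_of_ne hne with h | h
  · exact ⟨c, hbc, mem_regularPart_of_re_lt hL hm hβ h⟩
  · exact ⟨min c β.re, lt_min hbc h, mem_regularPart_of_re_ge hL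
      (regularPart_antitone hL (min_le_left _ _) hβ) (min_le_right _ _)⟩

theorem map_mem_deligneLattice (hD : IsRegularSingular D) (hD' : IsRegularSingular D')
    (f : R →ₗ[ℂ] R') (hsmul : ∀ (g : ℂ⸨X⸩) m, f (g • m) = rotateFormal ζ g • f m)
    (hχ : χ = 0 ∨ χ.order < 0) (hf : ∀ m, f (D.θ m) - D'.θ (f m) = χ • f m) {b : ℝ} {m : R}
    (hm : m ∈ deligneLattice D b) : f m ∈ deligneLattice D' b := by
  obtain ⟨L, hL⟩ := hD
  obtain ⟨L₁, hL₁⟩ := hD'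
  rcases hχ with rfl | hχ
  · rw [deligneLattice_eq hL] at hm
    rw [deligneLattice_eq hL₁]
    obtain ⟨T, hT⟩ := exists_map_mem_shift hL.fg hL₁.span_eq_top f hsmul
    refine map_mem_regularPart hL hL₁ f (fun m => ?_) T hT hm
    exact (sub_eq_zero.1 ((hf m).trans (zero_smul ℂ⸨X⸩ (f m)))).symm
  · rw [eq_zero_of_twist hL hL₁ f hsmul hχ hf]
    exact zero_mem _

theorem exists_eq_theta_add (hD : IsRegularSingular D) (hχ : χ.order < 0) {b : ℝ} {m : R}
    (hm : m ∈ deligneLattice D b) : ∃ m₀ ∈ deligneLattice D (b + 1),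
      ∃ m₁ ∈ deligneLattice D (b + 1), m = (D.θ m₀ + χ • m₀) + m₁ := by
  have hχ0 : χ ≠ 0 := by
    rintro rfl
    simp at hχ
  have hinv : χ⁻¹ • m ∈ deligneLattice D (b + 1) := by
    have hmem := formal_smul_mem _ (yPow_neg_one_mul_inv_mem hχ) hm
    rwa [← yPow_smul_mem_deligneLattice hD 1, smul_smul, ← mul_assoc, yPow_mul_neg, one_mul,
      Int.cast_one] at hmem
  refine ⟨_, hinv, _, neg_mem ((isLogLattice_deligneLattice hD (b + 1)).stable _ hinv), ?_⟩
  rw [smul_smul, mul_inv_cancel₀ hχ0, one_smul]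
  abel

end DeligneLattices

section Polar

theorem polarPart_coeff (φ : Polynomial ℂ) (n : ℤ) :
    (polarPart φ).coeff n = if n ≤ 0 then φ.coeff n.natAbs else 0 := by
  induction φ using Polynomial.induction_on' with
  | add p p' h h' =>
    rw [polarPart, map_add, HahnSeries.coeff_add]
    change (polarPart p).coeff n + (polarPart p').coeff n = _
    rw [h, h', Polynomial.coeff_add]
    split_ifs <;> simp
  | monomial k a =>
    rw [polarPart, Polynomial.aeval_monomial, HahnSeries.single_pow, ← Algebra.smul_def,
      HahnSeries.coeff_smul, HahnSeries.coeff_single, Polynomial.coeff_monomial]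
    simp only [nsmul_eq_mul, mul_neg, mul_one, one_pow, smul_eq_mul]
    split_ifs <;> first | omega | simp

theorem coeff_euler_polarPart (φ : Polynomial ℂ) {n : ℤ} (hn : 0 ≤ n) :
    (eulerFormal (polarPart φ)).coeff n = 0 := by
  rw [eulerFormal_coeff, polarPart_coeff]
  split_ifs with h
  · rw [le_antisymm h hn, Int.cast_zero, zero_mul]
  · rw [mul_zero]

theorem eq_zero_or_order_neg {f : ℂ⸨X⸩} (hf : ∀ n : ℤ, 0 ≤ n → f.coeff n = 0) :
    f = 0 ∨ f.order < 0 := by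
  by_contra! h
  exact h.1 (HahnSeries.coeff_order_eq_zero.1 (hf _ h.2))

theorem order_euler_polarPart_neg {φ : Polynomial ℂ} (h0 : φ.coeff 0 = 0) (hφ : φ ≠ 0) :
    (eulerFormal (polarPart φ)).order < 0 := by
  refine (eq_zero_or_order_neg fun n hn => coeff_euler_polarPart φ hn).resolve_left fun h => ?_
  refine hφ (Polynomial.ext fun k => ?_)
  rcases Nat.eq_zero_or_pos k with rfl | hk
  · exact h0
  · have hcoeff := congrArg (fun f : ℂ⸨X⸩ => f.coeff (-k)) h
    simp only [eulerFormal_coeff, polarPart_coeff, HahnSeries.coeff_zero] at hcoeff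
    rw [if_pos (by omega), Int.natAbs_neg, Int.natAbs_natCast] at hcoeff
    exact (mul_eq_zero.1 hcoeff).resolve_left (by exact_mod_cast (by omega : (-k : ℤ) ≠ 0))

end Polar

section Forms

variable {R : Type*} [AddCommGroup R] [Module ℂ⸨X⸩ R]

theorem exists_yPow_mul_mem_of_fg {L : Submodule FormalPower R} (hL : L.FG)
    (f : R →ₗ[ℂ⸨X⸩] ℂ⸨X⸩) : ∃ T : ℕ, ∀ r ∈ L, yPow T * f r ∈ FormalPower := by
  obtain ⟨s, rfl⟩ := hL
  refine ⟨s.sup fun r => (f r).order.natAbs, fun r hr => ?_⟩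
  induction hr using Submodule.span_induction with
  | mem r hr =>
    have hle := Finset.le_sup (f := fun r => (f r).order.natAbs) hr
    exact yPow_mul_mem (by omega)
  | zero => rw [map_zero, mul_zero]; exact zero_mem _
  | add r r' _ _ h h' => rw [map_add, mul_add]; exact add_mem h h'
  | smul g r _ h =>
    rw [Subring.smul_def, map_smul, smul_eq_mul, mul_left_comm]
    exact mul_mem g.2 h

variable [Module ℂ R] [IsScalarTower ℂ ℂ⸨X⸩ R] {R' : Type*} [AddCommGroup R'] [Module ℂ⸨X⸩ R']
  [Module ℂ R'] [IsScalarTower ℂ ℂ⸨X⸩ R'] {ζ : ℂˣ}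

theorem rotateFormal_algebraMap (ζ : ℂˣ) (c : ℂ) :
    rotateFormal ζ (algebraMap ℂ ℂ⸨X⸩ c) = algebraMap ℂ ℂ⸨X⸩ c := by
  ext n
  change ((_ : ℂˣ) : ℂ) * (HahnSeries.single 0 c).coeff n = (HahnSeries.single 0 c).coeff n
  rcases eq_or_ne n 0 with rfl | hn
  · simp
  · rw [HahnSeries.coeff_single_of_ne hn, mul_zero]

/-- A map which is semilinear for a rotation `y ↦ ζ y`, as a linear map over the field `ℂ` of
constants. -/
def complexLinear (f : R →ₛₗ[rotateFormal ζ] R') : R →ₗ[ℂ] R' where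
  toFun := f
  map_add' := map_add f
  map_smul' c r := by
    rw [← algebraMap_smul ℂ⸨X⸩ c r, map_smulₛₗ, rotateFormal_algebraMap, algebraMap_smul,
      RingHom.id_apply]

end Forms

namespace ElementaryModel

variable {W : Type*} [AddCommGroup W] [Module ℂ W] [Module ℂ⸨X⸩ W] {D : Connection eulerFormal W}
  (E : ElementaryModel D)

theorem iso_theta (z : W) (φ : E.Φ) : E.iso (D.θ z) φ =
    (E.conn φ).θ (E.iso z φ) + eulerFormal (polarPart φ) • E.iso z φ := by
  rw [E.iso_conn]
  rfl

open scoped Classical in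
/-- The inclusion of the summand `E^φ ⊗ R_φ` in `W`. -/
def incl (φ : E.Φ) : E.R φ →ₗ[ℂ⸨X⸩] W := E.iso.symm.toLinearMap ∘ₗ LinearMap.single ℂ⸨X⸩ E.R φ

/-- The projection of `W` to the summand `E^φ ⊗ R_φ`. -/
def component (φ : E.Φ) : W →ₗ[ℂ⸨X⸩] E.R φ := LinearMap.proj φ ∘ₗ E.iso.toLinearMap

theorem iso_incl_self (φ : E.Φ) (r : E.R φ) : E.iso (E.incl φ r) φ = r := by
  simp [incl]

theorem iso_incl_of_ne {φ ψ : E.Φ} (h : ψ ≠ φ) (r : E.R φ) : E.iso (E.incl φ r) ψ = 0 := by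
  simp [incl, h]

theorem sum_incl (z : W) : ∑ φ, E.incl φ (E.iso z φ) = z := by
  classical
  simp only [incl, LinearMap.comp_apply, LinearMap.coe_single, LinearEquiv.coe_coe]
  rw [← map_sum, Finset.univ_sum_single, LinearEquiv.symm_apply_apply]

theorem theta_incl (φ : E.Φ) (r : E.R φ) :
    D.θ (E.incl φ r) = E.incl φ ((E.conn φ).θ r + eulerFormal (polarPart φ) • r) := by
  apply E.iso.injective
  ext ψ
  rw [iso_theta]
  by_cases h : ψ = φ
  · subst h
    simp only [iso_incl_self]
  · simp only [iso_incl_of_ne E h, map_zero, smul_zero, add_zero]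

/-- The lattice `P^b(W)`. -/
def parabolicLattice (b : ℝ) : Submodule FormalPower W :=
  (Submodule.pi Set.univ fun φ => deligneLattice (E.conn φ) b).comap
    (E.iso.toLinearMap.restrictScalars FormalPower)

/-- The sum of the lattice `V^b R_0` and of all the irregular summands. -/
def regularLattice (b : ℝ) : Submodule FormalPower W :=
  (Submodule.pi {φ : E.Φ | (φ : Polynomial ℂ) = 0} fun φ => deligneLattice (E.conn φ) b).comap
    (E.iso.toLinearMap.restrictScalars FormalPower)

variable {E}

theorem mem_parabolicLattice {b : ℝ} {z : W} :
    z ∈ E.parabolicLattice b ↔ ∀ φ, E.iso z φ ∈ deligneLattice (E.conn φ) b :=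
  ⟨fun h φ => h φ trivial, fun h φ _ => h φ⟩

theorem mem_regularLattice {b : ℝ} {z : W} : z ∈ E.regularLattice b ↔
    ∀ φ : E.Φ, (φ : Polynomial ℂ) = 0 → E.iso z φ ∈ deligneLattice (E.conn φ) b := Iff.rfl

variable (E)

theorem parabolicLattice_antitone : Antitone E.parabolicLattice :=
  fun _ _ h _ hz φ hφ => deligneLattice_antitone (E.regular φ) h (hz φ hφ)

theorem regularLattice_antitone : Antitone E.regularLattice :=
  fun _ _ h _ hz φ hφ => deligneLattice_antitone (E.regular φ) h (hz φ hφ)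

theorem parabolicLattice_le_regularLattice (b : ℝ) :
    E.parabolicLattice b ≤ E.regularLattice b :=
  fun _ hz φ _ => hz φ trivial

theorem yPow_smul_mem_parabolicLattice (n : ℤ) (b : ℝ) (z : W) :
    yPow n • z ∈ E.parabolicLattice (b + n) ↔ z ∈ E.parabolicLattice b := by
  simp only [mem_parabolicLattice, map_smul, Pi.smul_apply,
    fun φ => yPow_smul_mem_deligneLattice (E.regular φ) n b]

theorem yPow_smul_mem_regularLattice (n : ℤ) (b : ℝ) (z : W) :
    yPow n • z ∈ E.regularLattice (b + n) ↔ z ∈ E.regularLattice b := by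
  simp only [mem_regularLattice, map_smul, Pi.smul_apply,
    fun φ => yPow_smul_mem_deligneLattice (E.regular φ) n b]

theorem exists_mem_parabolicLattice (z : W) : ∃ b, z ∈ E.parabolicLattice b := by
  choose b hb using fun φ => exists_mem_deligneLattice (E.regular φ) (E.iso z φ)
  obtain ⟨c, hc⟩ := (Set.finite_range b).bddBelow
  exact ⟨c, fun φ _ => deligneLattice_antitone (E.regular φ) (hc ⟨φ, rfl⟩) (hb φ)⟩

theorem mem_regularLattice_of_forall_lt {b : ℝ} {z : W} (h : ∀ c < b, z ∈ E.regularLattice c) :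
    z ∈ E.regularLattice b :=
  fun φ hφ => mem_deligneLattice_of_forall_lt (E.regular φ) fun c hc => h c hc φ hφ

theorem incl_mem_parabolicLattice {φ : E.Φ} {b : ℝ} {r : E.R φ}
    (hr : r ∈ deligneLattice (E.conn φ) b) : E.incl φ r ∈ E.parabolicLattice b := by
  rw [mem_parabolicLattice]
  intro ψ
  by_cases h : ψ = φ
  · subst h
    rwa [iso_incl_self]
  · rw [iso_incl_of_ne E h]
    exact zero_mem _

theorem iso_theta_of_eq_zero {φ : E.Φ} (hφ : (φ : Polynomial ℂ) = 0) (z : W) :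
    E.iso (D.θ z) φ = (E.conn φ).θ (E.iso z φ) := by
  have hpolar : polarPart (φ : Polynomial ℂ) = 0 := by rw [hφ, polarPart, map_zero]
  rw [iso_theta, hpolar, map_zero, zero_smul ℂ⸨X⸩ (E.iso z φ), add_zero]

theorem theta_mem_regularLattice {b : ℝ} {z : W} (hz : z ∈ E.regularLattice b) :
    D.θ z ∈ E.regularLattice b := mem_regularLattice.2 fun φ hφ => by
  rw [E.iso_theta_of_eq_zero hφ]
  exact (isLogLattice_deligneLattice (E.regular φ) b).stable _ (hz φ hφ)

theorem exists_theta_mem_parabolicLattice : ∃ K : ℕ, ∀ (b : ℝ), ∀ z ∈ E.parabolicLattice b,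
    D.θ z ∈ E.parabolicLattice (b - K) := by
  obtain ⟨K, hK⟩ := (Set.finite_range fun φ : E.Φ =>
    (eulerFormal (polarPart φ)).order.natAbs).bddAbove
  refine ⟨K, fun b z hz => mem_parabolicLattice.2 fun φ => ?_⟩
  have hzφ := mem_parabolicLattice.1 hz φ
  have horder : (eulerFormal (polarPart φ)).order.natAbs ≤ K := hK ⟨φ, rfl⟩
  have hregular : (E.conn φ).θ (E.iso z φ) ∈ deligneLattice (E.conn φ) (b - K) :=
    deligneLattice_antitone (E.regular φ) (sub_le_self b K.cast_nonneg)
      ((isLogLattice_deligneLattice (E.regular φ) b).stable _ hzφ)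
  have hpolar : eulerFormal (polarPart φ) • E.iso z φ ∈ deligneLattice (E.conn φ) (b - K) := by
    rw [← yPow_smul_mem_deligneLattice (E.regular φ) K, Int.cast_natCast, sub_add_cancel, smul_smul]
    exact formal_smul_mem _ (yPow_mul_mem (by omega)) hzφ
  rw [iso_theta]
  exact add_mem hregular hpolar

variable {E} in
theorem incl_mem_of_ne_zero {b : ℝ} {Z : AddSubmonoid W} (hZ : ∀ z ∈ Z, D.θ z ∈ Z)
    (hP : ∀ z ∈ E.parabolicLattice b, z ∈ Z) {φ : E.Φ} (hφ : (φ : Polynomial ℂ) ≠ 0) (r : E.R φ) :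
    E.incl φ r ∈ Z := by
  have hinduction : ∀ (k : ℕ), ∀ r ∈ deligneLattice (E.conn φ) (b - k), E.incl φ r ∈ Z := by
    intro k
    induction k with
    | zero => exact fun r hr => hP _ (E.incl_mem_parabolicLattice (by simpa using hr))
    | succ k ih =>
      intro r hr
      -- On an irregular summand, `V^{c}` is contained in `θ V^{c+1} + V^{c+1}`.
      obtain ⟨r₀, hr₀, r₁, hr₁, rfl⟩ :=
        exists_eq_theta_add (E.regular φ) (order_euler_polarPart_neg (E.coeff_zero φ φ.2) hφ) hr
      have hk : b - ((k + 1 : ℕ) : ℝ) + 1 = b - k := by push_cast; ring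
      rw [hk] at hr₀ hr₁
      rw [map_add, ← theta_incl]
      exact add_mem (hZ _ (ih _ hr₀)) (ih _ hr₁)
  obtain ⟨c, hc⟩ := exists_mem_deligneLattice (E.regular φ) r
  obtain ⟨k, hk⟩ := exists_nat_ge (b - c)
  exact hinduction k r (deligneLattice_antitone (E.regular φ) (by linarith) hc)

variable {E} in
theorem regularLattice_subset {b : ℝ} {Z : AddSubmonoid W} (hZ : ∀ z ∈ Z, D.θ z ∈ Z)
    (hP : ∀ z ∈ E.parabolicLattice b, z ∈ Z) {z : W} (hz : z ∈ E.regularLattice b) : z ∈ Z := by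
  rw [← E.sum_incl z]
  refine sum_mem fun φ _ => ?_
  by_cases hφ : (φ : Polynomial ℂ) = 0
  · exact hP _ (E.incl_mem_parabolicLattice (hz φ hφ))
  · exact incl_mem_of_ne_zero hZ hP hφ _

theorem map_mem_parabolicLattice {ζ : ℂˣ} (σ : W →ₛₗ[rotateFormal ζ] W)
    (hθ : ∀ z, D.θ (σ z) = σ (D.θ z)) {b : ℝ} {z : W} (hz : z ∈ E.parabolicLattice b) :
    σ z ∈ E.parabolicLattice b := by
  rw [mem_parabolicLattice]
  intro ψ
  rw [← E.sum_incl z, map_sum, map_sum, Finset.sum_apply]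
  refine sum_mem fun φ _ => ?_
  let f : E.R φ →ₛₗ[rotateFormal ζ] E.R ψ := (E.component ψ).comp (σ.comp (E.incl φ))
  -- The component `f` of `σ` is a rotation between the regular connections `R_φ` and `R_ψ`, up to
  -- the twist by the difference of the exponents.
  have hf : ∀ r, f ((E.conn φ).θ r) - (E.conn ψ).θ (f r) =
      (eulerFormal (polarPart ψ) - rotateFormal ζ (eulerFormal (polarPart φ))) • f r := by
    intro r
    have hrelation : f ((E.conn φ).θ r) + rotateFormal ζ (eulerFormal (polarPart φ)) • f r =
        (E.conn ψ).θ (f r) + eulerFormal (polarPart ψ) • f r := by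
      rw [← map_smulₛₗ, ← map_add]
      change E.iso (σ (E.incl φ _)) ψ = _
      rw [← theta_incl, ← hθ]
      exact E.iso_theta _ ψ
    rw [sub_smul, sub_eq_sub_iff_add_eq_add, hrelation, add_comm]
  exact map_mem_deligneLattice (E.regular φ) (E.regular ψ) (complexLinear f) (map_smulₛₗ f)
    (eq_zero_or_order_neg fun n hn => by
      rw [HahnSeries.coeff_sub, rotateFormal_coeff, coeff_euler_polarPart _ hn,
        coeff_euler_polarPart _ hn, mul_zero, sub_zero]) hf (mem_parabolicLattice.1 hz φ)

theorem exists_yPow_mul_mem (f : W →ₗ[ℂ⸨X⸩] ℂ⸨X⸩) (b : ℝ) :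
    ∃ T : ℕ, ∀ z ∈ E.parabolicLattice b, yPow T * f z ∈ FormalPower := by
  refine exists_yPow_mul_mem_of_fg ?_ f
  have hmap : E.parabolicLattice b = (Submodule.pi Set.univ fun φ =>
      deligneLattice (E.conn φ) b).map (E.iso.symm.toLinearMap.restrictScalars FormalPower) := by
    ext z
    refine ⟨fun hz => ⟨_, hz, E.iso.symm_apply_apply z⟩, ?_⟩
    rintro ⟨w, hw, rfl⟩
    change E.iso (E.iso.symm w) ∈ Submodule.pi Set.univ fun φ => deligneLattice (E.conn φ) b
    rwa [E.iso.apply_symm_apply]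
  rw [hmap]
  exact (Submodule.fg_pi fun φ => (isLogLattice_deligneLattice (E.regular φ) b).fg).map _

end ElementaryModel

section Averaging

theorem rotateFormal_eulerFormal (ζ : ℂˣ) (f : ℂ⸨X⸩) :
    rotateFormal ζ (eulerFormal f) = eulerFormal (rotateFormal ζ f) := by
  ext n
  rw [rotateFormal_coeff, eulerFormal_coeff, eulerFormal_coeff, rotateFormal_coeff]
  ring

variable (q : ℕ) [NeZero q]

/-- The coefficients of a Laurent series at the multiples of `q`. -/
def unramifySeries (f : ℂ⸨X⸩) : ℂ⸨X⸩ :=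
  HahnSeries.ofSuppBddBelow (fun n => f.coeff (q * n)) ⟨min f.order 0, fun n hn => by
    by_contra h
    push Not at h
    refine hn (HahnSeries.coeff_eq_zero_of_lt_order ?_)
    have hq : (1 : ℤ) ≤ q := by exact_mod_cast NeZero.pos q
    have horder := h.trans_le (min_le_left _ _)
    have hneg := h.trans_le (min_le_right _ _)
    nlinarith⟩

theorem unramifySeries_coeff (f : ℂ⸨X⸩) (n : ℤ) :
    (unramifySeries q f).coeff n = f.coeff (q * n) := rfl

theorem IsConvergent.unramify {f : ℂ⸨X⸩} (hf : IsConvergent f) :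
    IsConvergent (unramifySeries q f) := by
  obtain ⟨C, A, h⟩ := hf
  refine ⟨C, A ^ q, fun n => ?_⟩
  have hqn := h (q * n)
  push_cast at hqn
  rwa [unramifySeries_coeff, ← pow_mul]

/-- The primitive `q`-th root of unity `exp (2πi / q)`. -/
def primitiveRoot : rootsOfUnity q ℂ :=
  (Complex.isPrimitiveRoot_exp q (NeZero.ne q)).toRootsOfUnity

theorem sum_zpow_primitiveRoot (n : ℤ) :
    ∑ k ∈ Finset.range q, ((((primitiveRoot q ^ k : rootsOfUnity q ℂ) : ℂˣ) ^ n : ℂˣ) : ℂ) =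
      if (q : ℤ) ∣ n then (q : ℂ) else 0 := by
  have hprim := Complex.isPrimitiveRoot_exp q (NeZero.ne q)
  set z : ℂ := Complex.exp (2 * Real.pi * Complex.I / q)
  have hval : (((primitiveRoot q : rootsOfUnity q ℂ) : ℂˣ) : ℂ) = z :=
    IsPrimitiveRoot.val_toRootsOfUnity_coe hprim
  have hpow : ∀ k : ℕ, ((((primitiveRoot q ^ k : rootsOfUnity q ℂ) : ℂˣ) ^ n : ℂˣ) : ℂ) =
      (z ^ n) ^ k := fun k => by
    rw [SubgroupClass.coe_pow, ← zpow_natCast, ← zpow_mul, mul_comm, zpow_mul, zpow_natCast]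
    simp [hval]
  rw [Finset.sum_congr rfl fun k _ => hpow k]
  split_ifs with h
  · rw [(hprim.zpow_eq_one_iff_dvd n).2 h]
    simp
  · have hne : z ^ n ≠ 1 := fun h' => h ((hprim.zpow_eq_one_iff_dvd n).1 h')
    rw [geom_sum_eq hne, ← zpow_natCast, ← zpow_mul, mul_comm, zpow_mul, zpow_natCast,
      hprim.pow_eq_one, one_zpow, sub_self, zero_div]

theorem sum_rotateFormal (f : ℂ⸨X⸩) :
    ∑ k ∈ Finset.range q, rotateFormal (primitiveRoot q ^ k : rootsOfUnity q ℂ) f =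
      (q : ℂ) • ramifyFormal q (unramifySeries q f) := by
  ext n
  rw [HahnSeries.coeff_sum]
  simp only [rotateFormal_coeff]
  rw [← Finset.sum_mul, sum_zpow_primitiveRoot, HahnSeries.coeff_smul, smul_eq_mul]
  split_ifs with h
  · obtain ⟨m, rfl⟩ := h
    rw [ramifyFormal_coeff_mul, unramifySeries_coeff]
  · rw [ramifyFormal_coeff_of_not_dvd q _ n h, zero_mul, mul_zero]

theorem unramifySeries_ramifyFormal_mul (a f : ℂ⸨X⸩) :
    unramifySeries q (ramifyFormal q a * f) = a * unramifySeries q f := by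
  apply (ramifyFormal q).injective
  apply smul_right_injective ℂ⸨X⸩ (NeZero.ne (q : ℂ))
  simp only [map_mul]
  rw [← sum_rotateFormal, ← HahnSeries.C_mul_eq_smul, mul_left_comm, HahnSeries.C_mul_eq_smul,
    ← sum_rotateFormal, Finset.mul_sum]
  simp only [map_mul, rotate_ramify]

theorem unramifySeries_one : unramifySeries q 1 = 1 := by
  ext n
  simp [unramifySeries_coeff, HahnSeries.coeff_one, NeZero.ne q]

/-- The average under the `q`-th roots of unity, as a retraction of `ℂ{x}[1/x] → ℂ{y}[1/y]`. -/
def unramify : Ramified q →ₗ[ConvLaurent] ConvLaurent where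
  toFun f := ⟨unramifySeries q (algebraMap (Ramified q) ℂ⸨X⸩ f),
    IsConvergent.unramify q (Subtype.property (p := fun f => f ∈ ConvLaurent) f)⟩
  map_add' _ _ := rfl
  map_smul' a f := Subtype.ext
    (unramifySeries_ramifyFormal_mul q (a : ℂ⸨X⸩) (algebraMap (Ramified q) ℂ⸨X⸩ f))

theorem sum_rotateRam (f : Ramified q) :
    ∑ k ∈ Finset.range q, rotateRam q (primitiveRoot q ^ k) f =
      (q : ℂ) • algebraMap ConvLaurent (Ramified q) (unramify q f) := by
  apply (algebraMap (Ramified q) ℂ⸨X⸩).injective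
  rw [map_sum]
  exact sum_rotateFormal q (algebraMap (Ramified q) ℂ⸨X⸩ f)

theorem unramify_one : unramify q 1 = 1 := Subtype.ext (unramifySeries_one q)

theorem unramify_euler (f : Ramified q) :
    unramify q (eulerRam q f) = (q : ℂ) • eulerConv (unramify q f) := by
  refine Subtype.ext (HahnSeries.ext (funext fun n => ?_))
  change (unramifySeries q (eulerFormal (algebraMap (Ramified q) ℂ⸨X⸩ f))).coeff n =
    ((q : ℂ) • eulerFormal (unramifySeries q (algebraMap (Ramified q) ℂ⸨X⸩ f))).coeff n
  rw [unramifySeries_coeff, eulerFormal_coeff, HahnSeries.coeff_smul, eulerFormal_coeff,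
    unramifySeries_coeff, smul_eq_mul]
  push_cast
  ring

variable (M : Type*) [AddCommGroup M] [Module ConvLaurent M]

/-- The projection of `π⁺M` onto `M` given by the average under the `q`-th roots of unity. -/
def descend : RamPullback q M →ₗ[ConvLaurent] M :=
  TensorProduct.lid ConvLaurent M ∘ₗ LinearMap.rTensor M (unramify q)

instance : IsScalarTower ℂ ℂ⸨X⸩ ℂ⸨X⸩ :=
  ⟨fun c g h => by rw [smul_eq_mul, smul_eq_mul, ← HahnSeries.C_mul_eq_smul,
    ← HahnSeries.C_mul_eq_smul, mul_assoc]⟩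

instance : IsScalarTower ℂ ℂ⸨X⸩ (ℂ⸨X⸩ ⊗[Ramified q] RamPullback q M) := by
  refine ⟨fun c g z => ?_⟩
  induction z using TensorProduct.induction_on with
  | zero => simp
  | add z z' h h' => simp only [smul_add, h, h']
  | tmul g' n =>
    rw [TensorProduct.smul_tmul', TensorProduct.smul_tmul', TensorProduct.smul_tmul', smul_eq_mul,
      smul_eq_mul, smul_mul_assoc]

variable {M}

theorem descend_tmul (g : Ramified q) (m : M) :
    descend q M (g ⊗ₜ m) = unramify q g • m := by
  simp [descend]

theorem descend_one_tmul (m : M) : descend q M ((1 : Ramified q) ⊗ₜ m) = m := by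
  rw [descend_tmul, unramify_one, one_smul]

theorem galoisAct_tmul (ζ : rootsOfUnity q ℂ) (g : Ramified q) (m : M) :
    galoisAct q M ζ (g ⊗ₜ m) = rotateRam q ζ g ⊗ₜ m := rfl

theorem rotateRam_one (ζ : rootsOfUnity q ℂ) : rotateRam q ζ 1 = 1 :=
  Subtype.ext (map_one (rotateFormal ζ))

theorem sum_galoisAct (n : RamPullback q M) :
    ∑ k ∈ Finset.range q, galoisAct q M (primitiveRoot q ^ k) n =
      (q : ℂ) • ((1 : Ramified q) ⊗ₜ[ConvLaurent] descend q M n) := by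
  induction n using TensorProduct.induction_on with
  | zero => simp
  | add n n' h h' =>
    simp only [map_add, Finset.sum_add_distrib, h, h', TensorProduct.tmul_add, smul_add]
  | tmul g m =>
    simp only [galoisAct_tmul]
    rw [← TensorProduct.sum_tmul, sum_rotateRam, descend_tmul, ← TensorProduct.smul_tmul,
      TensorProduct.smul_tmul', Algebra.algebraMap_eq_smul_one]

/-- The rotation `f(y) ↦ f(ζ y)` of `ℂ{y}[1/y]`. -/
def rotateRamHom (ζ : rootsOfUnity q ℂ) : Ramified q →+* Ramified q where
  toFun := rotateRam q ζ
  map_one' := rotateRam_one q ζ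
  map_mul' f g := Subtype.ext (map_mul (rotateFormal ζ) (algebraMap (Ramified q) ℂ⸨X⸩ f)
    (algebraMap (Ramified q) ℂ⸨X⸩ g))
  map_zero' := map_zero _
  map_add' := map_add _

theorem galoisAct_smul (ζ : rootsOfUnity q ℂ) (f : Ramified q) (n : RamPullback q M) :
    galoisAct q M ζ (f • n) = rotateRamHom q ζ f • galoisAct q M ζ n := by
  induction n using TensorProduct.induction_on with
  | zero => simp
  | add n n' h h' => simp only [map_add, smul_add, h, h']
  | tmul g m =>
    rw [TensorProduct.smul_tmul', galoisAct_tmul, galoisAct_tmul, TensorProduct.smul_tmul',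
      smul_eq_mul, smul_eq_mul]
    congr 1
    exact map_mul (rotateRamHom q ζ) f g

variable (M) in
/-- The additive map underlying `galoisFormal`. -/
def galoisFormalAddHom (ζ : rootsOfUnity q ℂ) :
    ℂ⸨X⸩ ⊗[Ramified q] RamPullback q M →+ ℂ⸨X⸩ ⊗[Ramified q] RamPullback q M :=
  TensorProduct.liftAddHom
    { toFun := fun g =>
        { toFun := fun n => rotateFormal ζ g ⊗ₜ galoisAct q M ζ n
          map_zero' := by simp
          map_add' := fun n n' => by rw [map_add, TensorProduct.tmul_add] }
      map_zero' := by ext n; simp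
      map_add' := fun g g' => by ext n; simp [TensorProduct.add_tmul] }
    (fun f g n => by
      simp only [AddMonoidHom.coe_mk, ZeroHom.coe_mk]
      rw [galoisAct_smul, ← TensorProduct.smul_tmul, Algebra.smul_def, Algebra.smul_def, map_mul]
      rfl)

theorem galoisFormalAddHom_tmul (ζ : rootsOfUnity q ℂ) (g : ℂ⸨X⸩) (n : RamPullback q M) :
    galoisFormalAddHom q M ζ (g ⊗ₜ n) = rotateFormal ζ g ⊗ₜ galoisAct q M ζ n := rfl

variable (M) in
/-- The action of a root of unity on the formalization of `π⁺M`, semilinear for the rotation of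
`ℂ((y))`. -/
def galoisFormal (ζ : rootsOfUnity q ℂ) :
    ℂ⸨X⸩ ⊗[Ramified q] RamPullback q M →ₛₗ[rotateFormal ζ]
      ℂ⸨X⸩ ⊗[Ramified q] RamPullback q M where
  toFun := galoisFormalAddHom q M ζ
  map_add' := map_add _
  map_smul' g z := by
    induction z with
    | zero => simp
    | add z z' h h' => simp only [map_add, smul_add, h, h']
    | tmul g' n =>
      rw [TensorProduct.smul_tmul', galoisFormalAddHom_tmul, galoisFormalAddHom_tmul,
        TensorProduct.smul_tmul', smul_eq_mul, smul_eq_mul, map_mul]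

theorem galoisFormal_tmul (ζ : rootsOfUnity q ℂ) (g : ℂ⸨X⸩) (n : RamPullback q M) :
    galoisFormal q M ζ (g ⊗ₜ n) = rotateFormal ζ g ⊗ₜ galoisAct q M ζ n := rfl

theorem one_tmul_smul (g : Ramified q) (n : RamPullback q M) :
    (1 : ℂ⸨X⸩) ⊗ₜ[Ramified q] (g • n) = algebraMap (Ramified q) ℂ⸨X⸩ g ⊗ₜ[Ramified q] n := by
  rw [← TensorProduct.smul_tmul, Algebra.smul_def, mul_one]

variable [Module ℂ M] (D : Connection eulerConv M)

theorem ramPullback_tmul (g : Ramified q) (m : M) : (D.ramPullback q).θ (g ⊗ₜ m) =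
    eulerRam q g ⊗ₜ[ConvLaurent] m + ((q : ℂ) • g) ⊗ₜ[ConvLaurent] D.θ m := rfl

theorem galoisAct_theta (ζ : rootsOfUnity q ℂ) (n : RamPullback q M) :
    galoisAct q M ζ ((D.ramPullback q).θ n) = (D.ramPullback q).θ (galoisAct q M ζ n) := by
  induction n using TensorProduct.induction_on with
  | zero => simp
  | add n n' h h' => simp only [map_add, h, h']
  | tmul g m =>
    rw [ramPullback_tmul, map_add, galoisAct_tmul, galoisAct_tmul, galoisAct_tmul,
      ramPullback_tmul, LinearMap.map_smul_of_tower]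
    congr 2
    exact Subtype.ext (rotateFormal_eulerFormal ζ _)

theorem formalization_tmul (g : ℂ⸨X⸩) (n : RamPullback q M) :
    (D.ramPullback q).formalization.θ (g ⊗ₜ n) =
      eulerFormal g ⊗ₜ[Ramified q] n + g ⊗ₜ[Ramified q] (D.ramPullback q).θ n := by
  rw [Connection.formalization, Connection.baseChange_tmul, one_smul]

theorem galoisFormal_theta (ζ : rootsOfUnity q ℂ) (z : ℂ⸨X⸩ ⊗[Ramified q] RamPullback q M) :
    (D.ramPullback q).formalization.θ (galoisFormal q M ζ z) =
      galoisFormal q M ζ ((D.ramPullback q).formalization.θ z) := by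
  induction z with
  | zero => simp
  | add z z' h h' => simp only [map_add, h, h']
  | tmul g n =>
    rw [formalization_tmul, map_add, galoisFormal_tmul, galoisFormal_tmul, galoisFormal_tmul,
      formalization_tmul, galoisAct_theta, rotateFormal_eulerFormal]

variable {D} (E : ElementaryModel (D.ramPullback q).formalization)

theorem exists_eq_one_tmul_add (z : ℂ⸨X⸩ ⊗[Ramified q] RamPullback q M) (c : ℝ) :
    ∃ n : RamPullback q M, ∃ w ∈ E.parabolicLattice c,
      z = (1 : ℂ⸨X⸩) ⊗ₜ[Ramified q] n + w := by
  induction z with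
  | zero => exact ⟨0, 0, zero_mem _, by simp⟩
  | add z z' h h' =>
    obtain ⟨n, w, hw, rfl⟩ := h
    obtain ⟨n', w', hw', rfl⟩ := h'
    exact ⟨n + n', w + w', add_mem hw hw', by rw [TensorProduct.tmul_add]; abel⟩
  | tmul g n =>
    obtain ⟨b, hb⟩ := E.exists_mem_parabolicLattice ((1 : ℂ⸨X⸩) ⊗ₜ[Ramified q] n)
    obtain ⟨T, hT⟩ := exists_nat_ge (c - b)
    obtain ⟨a, h, hh, rfl⟩ := exists_convLaurent_add_yPow_mul g T
    have hsmall : (yPow T * h) ⊗ₜ[Ramified q] n ∈ E.parabolicLattice (b + T) := by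
      have hmem := formal_smul_mem _ hh ((E.yPow_smul_mem_parabolicLattice T b _).2 hb)
      rwa [smul_smul, TensorProduct.smul_tmul', smul_eq_mul, mul_one, mul_comm,
        Int.cast_natCast] at hmem
    refine ⟨(show Ramified q from a) • n, _,
      E.parabolicLattice_antitone (by linarith) hsmall, ?_⟩
    rw [one_tmul_smul, TensorProduct.add_tmul]
    rfl

theorem galoisAct_mem_parabolicRam (ζ : rootsOfUnity q ℂ) {b : ℝ} {n : RamPullback q M}
    (hn : n ∈ parabolicRam E b) : galoisAct q M ζ n ∈ parabolicRam E b := by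
  have hmem := E.map_mem_parabolicLattice (galoisFormal q M ζ) (galoisFormal_theta q D ζ)
    (ElementaryModel.mem_parabolicLattice.2 hn)
  rw [galoisFormal_tmul, map_one] at hmem
  exact ElementaryModel.mem_parabolicLattice.1 hmem

theorem descend_mem_parabolic {b : ℝ} {n : RamPullback q M}
    (hn : n ∈ parabolicRam E (q * b)) : descend q M n ∈ parabolic E b := by
  have hsum : (1 : ℂ⸨X⸩) ⊗ₜ[Ramified q]
      (∑ k ∈ Finset.range q, galoisAct q M (primitiveRoot q ^ k) n) ∈
        E.parabolicLattice (q * b) := by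
    rw [TensorProduct.tmul_sum]
    exact sum_mem fun k _ => ElementaryModel.mem_parabolicLattice.2
      (galoisAct_mem_parabolicRam q E _ hn)
  rw [sum_galoisAct, TensorProduct.tmul_smul] at hsum
  have haverage := complex_smul_mem _ (q : ℂ)⁻¹ hsum
  rw [smul_smul, inv_mul_cancel₀ (NeZero.ne (q : ℂ)), one_smul] at haverage
  refine ⟨ElementaryModel.mem_parabolicLattice.1 haverage, fun ζ => ?_⟩
  rw [galoisAct_tmul, rotateRam_one]

variable [IsScalarTower ℂ ConvLaurent M]

theorem descend_theta (D : Connection eulerConv M) (n : RamPullback q M) :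
    descend q M ((D.ramPullback q).θ n) = (q : ℂ) • D.θ (descend q M n) := by
  induction n using TensorProduct.induction_on with
  | zero => simp
  | add n n' h h' => simp only [map_add, h, h', smul_add]
  | tmul g m =>
    rw [ramPullback_tmul, map_add, descend_tmul, descend_tmul, descend_tmul, unramify_euler,
      D.leibniz, smul_add, smul_assoc, LinearMap.map_smul_of_tower, smul_assoc]

end Averaging

section Finiteness

theorem fg_span_of_le_sup {k A M : Type*} [Field k] [Ring A] [SMul k A] [AddCommGroup M]
    [Module k M] [Module A M] [IsScalarTower k A M] {s : Set M} {G : Submodule k M}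
    {Y : Submodule A M} [FiniteDimensional k G] (hY : Y.FG) (hYs : Y ≤ Submodule.span A s)
    (hs : s ⊆ (G ⊔ Y.restrictScalars k : Submodule k M)) : (Submodule.span A s).FG := by
  set N := Submodule.span A s
  obtain ⟨t, ht⟩ := (Submodule.fg_iff_finiteDimensional (G ⊓ N.restrictScalars k)).2 inferInstance
  have htN : (t : Set M) ⊆ N := fun m hm => (ht.le (Submodule.subset_span hm)).2
  have htZ : G ⊓ N.restrictScalars k ≤ (Submodule.span A (t : Set M)).restrictScalars k := by
    rw [← ht, Submodule.span_le]
    exact Submodule.subset_span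
  have hN : N = Y ⊔ Submodule.span A (t : Set M) := by
    refine le_antisymm (Submodule.span_le.2 fun m hm => ?_) (sup_le hYs (Submodule.span_le.2 htN))
    obtain ⟨g, hg, y, hy, rfl⟩ := Submodule.mem_sup.1 (hs hm)
    have hgN : g ∈ N := (Submodule.add_mem_iff_left N (hYs hy)).1 (Submodule.subset_span hm)
    exact add_mem (Submodule.mem_sup_right (htZ ⟨hg, hgN⟩)) (Submodule.mem_sup_left hy)
  rw [hN]
  exact hY.sup (Submodule.fg_span t.finite_toSet)

variable {M : Type*} [AddCommGroup M] [Module ℂ M] [Module ConvLaurent M]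
  [IsScalarTower ℂ ConvLaurent M] {D : Connection eulerConv M}

theorem finiteDimensional_gr_of_map {F : Type*} [AddCommGroup F] [Module ℂ F] (f : M →ₗ[ℂ] F)
    {V : ℝ → Submodule (LogOps D) M} {b : ℝ} {A B : Submodule ℂ F}
    [FiniteDimensional ℂ (B ⧸ A.submoduleOf B)] (hB : ∀ m ∈ V b, f m ∈ B)
    (hA : ∀ m ∈ V b, f m ∈ A → m ∈ filtGt V b) : FiniteDimensional ℂ (Gr V b) := by
  let p : V b →ₗ[ℂ] Gr V b := ((filtGt V b).submoduleOf (V b)).mkQ.restrictScalars ℂ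
  let g : V b →ₗ[ℂ] B ⧸ A.submoduleOf B :=
    (A.submoduleOf B).mkQ ∘ₗ f.restrict (p := toComplex (V b)) hB
  have hker : LinearMap.ker g ≤ LinearMap.ker p := fun m hm =>
    (Submodule.Quotient.mk_eq_zero ((filtGt V b).submoduleOf (V b))).2
      (hA m m.2 ((Submodule.Quotient.mk_eq_zero (A.submoduleOf B)).1 hm))
  have : FiniteDimensional ℂ (V b ⧸ LinearMap.ker g) := g.quotKerEquivRange.symm.finiteDimensional
  refine Module.Finite.of_surjective ((LinearMap.ker g).liftQ p hker) fun x => ?_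
  obtain ⟨m, rfl⟩ := Submodule.Quotient.mk_surjective _ x
  exact ⟨Submodule.Quotient.mk m, rfl⟩

theorem exists_finiteDimensional_smul_mem_sup (D : Connection eulerConv M) (v : M) (S T : ℕ) :
    ∃ G : Submodule ℂ M, FiniteDimensional ℂ G ∧
      ∀ Y : Submodule (LogOps D) M, coordX ^ T • v ∈ Y →
        ∀ a, coordX ^ S * a ∈ ConvPower → a • v ∈ G ⊔ toComplex Y := by
  refine ⟨(truncations (S + T)).map ((LinearMap.toSpanSingleton ConvLaurent M
    ((coordX ^ S)⁻¹ • v)).restrictScalars ℂ), inferInstance, fun Y hv a ha => ?_⟩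
  obtain ⟨f, hf, u, hu, he⟩ := exists_truncation_convPower ha (S + T)
  have hcoord : coordX ^ S ≠ 0 := pow_ne_zero _ coordX_ne_zero
  have hsplit : a = f * (coordX ^ S)⁻¹ + u * coordX ^ T := by
    refine mul_left_cancel₀ hcoord (he.trans ?_)
    field_simp
    ring
  rw [hsplit, add_smul, mul_smul, mul_smul]
  exact Submodule.add_mem_sup ⟨f, hf, rfl⟩ (conv_smul_mem Y hu hv)

end Finiteness

section Existence

theorem ramifyFormal_mem (q : ℕ) [NeZero q] {f : ℂ⸨X⸩} (hf : f ∈ FormalPower) :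
    ramifyFormal q f ∈ FormalPower := by
  rw [mem_formalPower_iff] at hf ⊢
  intro n hn
  by_cases h : (q : ℤ) ∣ n
  · obtain ⟨m, rfl⟩ := h
    rw [ramifyFormal_coeff_mul]
    exact hf m (neg_of_mul_neg_right hn (Int.natCast_nonneg q))
  · exact ramifyFormal_coeff_of_not_dvd q _ n h

theorem ramifyFormal_yPow (q : ℕ) [NeZero q] (n : ℤ) :
    ramifyFormal q (yPow n) = yPow (q * n) :=
  HahnSeries.embDomain_single

theorem yPow_mul_mem_of_ramifyFormal {q : ℕ} [NeZero q] {f : ℂ⸨X⸩} {T : ℕ}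
    (hf : yPow T * ramifyFormal q f ∈ FormalPower) : yPow T * f ∈ FormalPower := by
  have hq : (1 : ℤ) ≤ q := by exact_mod_cast NeZero.pos q
  have hmul : ramifyFormal q (yPow T * f) ∈ FormalPower := by
    have hpow : yPow (q * T : ℤ) = yPow ((q - 1) * T : ℤ) * yPow T := by
      rw [yPow_mul]
      ring_nf
    rw [map_mul, ramifyFormal_yPow, hpow, mul_assoc]
    exact mul_mem (yPow_mem (mul_nonneg (by omega) (Int.natCast_nonneg T))) hf
  rw [mem_formalPower_iff] at hmul ⊢
  intro n hn
  rw [← ramifyFormal_coeff_mul q]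
  exact hmul _ (mul_neg_of_pos_of_neg (by omega) hn)

theorem one_tmul_one_tmul_smul (q : ℕ) [NeZero q] {M : Type*} [AddCommGroup M]
    [Module ConvLaurent M] (a : ConvLaurent) (m : M) :
    (1 : ℂ⸨X⸩) ⊗ₜ[Ramified q] ((1 : Ramified q) ⊗ₜ[ConvLaurent] (a • m)) =
      ramifyFormal q a • (1 : ℂ⸨X⸩) ⊗ₜ[Ramified q] ((1 : Ramified q) ⊗ₜ[ConvLaurent] m) := by
  have hbase : (1 : Ramified q) ⊗ₜ[ConvLaurent] (a • m) =
      algebraMap ConvLaurent (Ramified q) a • ((1 : Ramified q) ⊗ₜ[ConvLaurent] m) := by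
    rw [← TensorProduct.smul_tmul, TensorProduct.smul_tmul', Algebra.smul_def, smul_eq_mul]
  rw [hbase, one_tmul_smul, TensorProduct.smul_tmul', smul_eq_mul, mul_one]
  rfl

variable {M : Type*} [AddCommGroup M] [Module ℂ M] [Module ConvLaurent M]
  [IsScalarTower ℂ ConvLaurent M] {q : ℕ} [NeZero q]

variable (q M) in
/-- The embedding `m ↦ 1 ⊗ (1 ⊗ m)` of `M` in the formalization of `π⁺M`. -/
def embed : M →ₗ[ℂ] ℂ⸨X⸩ ⊗[Ramified q] RamPullback q M where
  toFun m := (1 : ℂ⸨X⸩) ⊗ₜ ((1 : Ramified q) ⊗ₜ m)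
  map_add' m m' := by rw [TensorProduct.tmul_add, TensorProduct.tmul_add]
  map_smul' c m := by
    rw [← algebraMap_smul ConvLaurent c m, one_tmul_one_tmul_smul, RingHom.id_apply,
      ← algebraMap_smul ℂ⸨X⸩ c]
    congr 1
    exact HahnSeries.embDomainRingHom_C

theorem embed_apply (m : M) :
    embed M q m = (1 : ℂ⸨X⸩) ⊗ₜ[Ramified q] ((1 : Ramified q) ⊗ₜ[ConvLaurent] m) := rfl

theorem embed_smul (a : ConvLaurent) (m : M) :
    embed M q (a • m) = ramifyFormal q a • embed M q m :=
  one_tmul_one_tmul_smul q a m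

theorem embed_coordX_pow_smul (k : ℕ) (m : M) :
    embed M q (coordX ^ k • m) = yPow (q * k) • embed M q m := by
  rw [embed_smul, ← zpow_natCast, coe_coordX_zpow, ramifyFormal_yPow]

variable {D : Connection eulerConv M}

theorem embed_theta (m : M) : (D.ramPullback q).formalization.θ (embed M q m) =
    (q : ℂ) • embed M q (D.θ m) := by
  rw [embed_apply, formalization_tmul, ramPullback_tmul, Derivation.map_one_eq_zero,
    Derivation.map_one_eq_zero, TensorProduct.zero_tmul, TensorProduct.zero_tmul, zero_add,
    zero_add, ← TensorProduct.smul_tmul', TensorProduct.tmul_smul]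
  rfl

variable (E : ElementaryModel (D.ramPullback q).formalization)

/-- The complex vector space `P^b(M)`, read in the formalization of `π⁺M`. -/
def parabolicSpace (b : ℝ) : Submodule ℂ M :=
  (latticeSpace (E.parabolicLattice (q * b))).comap (embed M q)

theorem mem_parabolicSpace {b : ℝ} {m : M} :
    m ∈ parabolicSpace E b ↔ embed M q m ∈ E.parabolicLattice (q * b) := Iff.rfl

theorem mem_parabolic {b : ℝ} {m : M} : m ∈ parabolic E b ↔ m ∈ parabolicSpace E b := by
  rw [mem_parabolicSpace, ElementaryModel.mem_parabolicLattice]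
  refine ⟨fun h => h.1, fun h => ⟨h, fun ζ => ?_⟩⟩
  rw [galoisAct_tmul, rotateRam_one]

theorem exists_coordX_pow_smul_mem_parabolicSpace (m : M) (b : ℝ) :
    ∃ T : ℕ, coordX ^ T • m ∈ parabolicSpace E b := by
  obtain ⟨c, hc⟩ := E.exists_mem_parabolicLattice (embed M q m)
  obtain ⟨T, hT⟩ := exists_nat_ge (q * b - c)
  refine ⟨T, ?_⟩
  rw [mem_parabolicSpace, embed_coordX_pow_smul]
  refine E.parabolicLattice_antitone ?_ ((E.yPow_smul_mem_parabolicLattice (q * T) c _).2 hc)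
  have hq : (T : ℝ) ≤ q * T := le_mul_of_one_le_left T.cast_nonneg
    (Nat.one_le_cast.2 (NeZero.pos q))
  push_cast
  linarith

theorem exists_linearMap_embed (f : M →ₗ[ConvLaurent] ConvLaurent) :
    ∃ g : ℂ⸨X⸩ ⊗[Ramified q] RamPullback q M →ₗ[ℂ⸨X⸩] ℂ⸨X⸩,
      ∀ m, g (embed M q m) = ramifyFormal q (f m) := by
  let f' : RamPullback q M →ₗ[Ramified q] Ramified q :=
    LinearMap.liftBaseChange (Ramified q) (Algebra.linearMap ConvLaurent (Ramified q) ∘ₗ f)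
  refine ⟨LinearMap.liftBaseChange ℂ⸨X⸩ (Algebra.linearMap (Ramified q) ℂ⸨X⸩ ∘ₗ f'), fun m => ?_⟩
  simp only [f', embed_apply, LinearMap.liftBaseChange_tmul, one_smul, LinearMap.comp_apply,
    Algebra.linearMap_apply]
  rfl

theorem exists_coordX_pow_mul_mem_convPower (f : M →ₗ[ConvLaurent] ConvLaurent) (b : ℝ) :
    ∃ T : ℕ, ∀ m ∈ parabolicSpace E b, coordX ^ T * f m ∈ ConvPower := by
  obtain ⟨g, hg⟩ := exists_linearMap_embed (q := q) f
  obtain ⟨T, hT⟩ := E.exists_yPow_mul_mem g (q * b)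
  refine ⟨T, fun m hm => ?_⟩
  have hmem := hT _ hm
  rw [hg] at hmem
  rw [mem_convPower, MulMemClass.coe_mul, ← zpow_natCast, coe_coordX_zpow]
  exact yPow_mul_mem_of_ramifyFormal hmem

theorem fg_span_parabolic [FiniteDimensional ConvLaurent M] (b : ℝ) :
    (Submodule.span (LogOps D) (parabolic E b)).FG := by
  let e := Module.finBasis ConvLaurent M
  choose T hT using fun i => exists_coordX_pow_smul_mem_parabolicSpace E (e i) b
  choose S hS using fun i => exists_coordX_pow_mul_mem_convPower E (e.coord i) b
  choose G _ hG using fun i => exists_finiteDimensional_smul_mem_sup D (e i) (S i) (T i)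
  refine fg_span_of_le_sup (G := ⨆ i, G i)
    (Submodule.fg_span (Set.finite_range fun i => coordX ^ T i • e i))
    (Submodule.span_mono (Set.range_subset_iff.2 fun i => (mem_parabolic E).2 (hT i)))
    fun m hm => ?_
  rw [← e.sum_repr m]
  exact sum_mem fun i _ => sup_le_sup_right (le_iSup G i) _
    (hG i _ (Submodule.subset_span (Set.mem_range_self i)) _ (hS i m ((mem_parabolic E).1 hm)))

/-- The elements of `M` whose component in `R_0` belongs to `V^{qb} R_0`; they turn out to form the
step `V^b M` of the Deligne filtration. -/
def deligneStep (b : ℝ) : Submodule (LogOps D) M :=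
  ofStable ((latticeSpace (E.regularLattice (q * b))).comap (embed M q))
    (fun m h => by
      have hθ := complex_smul_mem _ (q : ℂ)⁻¹ (E.theta_mem_regularLattice h)
      rwa [embed_theta, smul_smul, inv_mul_cancel₀ (NeZero.ne (q : ℂ)), one_smul] at hθ)
    (fun a ha m h => by
      rw [Submodule.mem_comap, embed_smul]
      exact formal_smul_mem _ (ramifyFormal_mem q (mem_convPower.1 ha)) h)

theorem mem_deligneStep {b : ℝ} {m : M} :
    m ∈ deligneStep E b ↔ embed M q m ∈ E.regularLattice (q * b) := Iff.rfl

theorem deligneStep_antitone : Antitone (deligneStep E) := fun _ _ h _ hm =>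
  E.regularLattice_antitone (mul_le_mul_of_nonneg_left h q.cast_nonneg) hm

/-- The elements of the formalization of `π⁺M` which are approximated to any order, in the
parabolic filtration, by elements of `π⁺M` whose averages belong to `Y`. -/
def approximable (Y : Submodule (LogOps D) M) :
    AddSubmonoid (ℂ⸨X⸩ ⊗[Ramified q] RamPullback q M) where
  carrier := {w | ∀ c, ∃ n : RamPullback q M, descend q M n ∈ Y ∧
    ∃ p ∈ E.parabolicLattice c, w = (1 : ℂ⸨X⸩) ⊗ₜ[Ramified q] n + p}
  zero_mem' c := ⟨0, by rw [map_zero]; exact zero_mem _, 0, zero_mem _, by simp⟩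
  add_mem' h h' c := by
    obtain ⟨n, hn, p, hp, rfl⟩ := h c
    obtain ⟨n', hn', p', hp', rfl⟩ := h' c
    exact ⟨n + n', by rw [map_add]; exact add_mem hn hn', p + p', add_mem hp hp',
      by rw [TensorProduct.tmul_add]; abel⟩

variable {E} {b : ℝ} {Y : Submodule (LogOps D) M}

theorem theta_mem_approximable {z : ℂ⸨X⸩ ⊗[Ramified q] RamPullback q M}
    (hz : z ∈ approximable E Y) : (D.ramPullback q).formalization.θ z ∈ approximable E Y := by
  intro c
  obtain ⟨K, hK⟩ := E.exists_theta_mem_parabolicLattice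
  obtain ⟨n, hn, p, hp, rfl⟩ := hz (c + K)
  refine ⟨(D.ramPullback q).θ n, ?_, _, add_sub_cancel_right c (K : ℝ) ▸ hK _ p hp, ?_⟩
  · rw [descend_theta]
    exact (toComplex Y).smul_mem _ (theta_mem Y hn)
  · rw [map_add, formalization_tmul, Derivation.map_one_eq_zero, TensorProduct.zero_tmul, zero_add]

theorem descend_mem_of_parabolic_subset (hY : parabolic E b ⊆ Y) {n : RamPullback q M}
    (hn : (1 : ℂ⸨X⸩) ⊗ₜ[Ramified q] n ∈ E.parabolicLattice (q * b)) : descend q M n ∈ Y :=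
  hY (descend_mem_parabolic q E (ElementaryModel.mem_parabolicLattice.1 hn))

theorem mem_approximable_of_mem_parabolicLattice (hY : parabolic E b ⊆ Y)
    {z : ℂ⸨X⸩ ⊗[Ramified q] RamPullback q M} (hz : z ∈ E.parabolicLattice (q * b)) :
    z ∈ approximable E Y := by
  intro c
  obtain ⟨n, w, hw, rfl⟩ := exists_eq_one_tmul_add q E z (max c (q * b))
  refine ⟨n, descend_mem_of_parabolic_subset hY ?_, w,
    E.parabolicLattice_antitone (le_max_left _ _) hw, rfl⟩
  exact (Submodule.add_mem_iff_left _ (E.parabolicLattice_antitone (le_max_right _ _) hw)).1 hz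

theorem mem_of_embed_mem_approximable (hY : parabolic E b ⊆ Y) {m : M}
    (hm : embed M q m ∈ approximable E Y) : m ∈ Y := by
  obtain ⟨n, hn, p, hp, he⟩ := hm (q * b)
  have hdiff : (1 : ℂ⸨X⸩) ⊗ₜ[Ramified q] ((1 : Ramified q) ⊗ₜ[ConvLaurent] m - n) = p := by
    rw [TensorProduct.tmul_sub, ← embed_apply]
    exact sub_eq_iff_eq_add'.2 he
  have hdescend := descend_mem_of_parabolic_subset hY (hdiff ▸ hp)
  rw [map_sub, descend_one_tmul] at hdescend
  exact (Submodule.sub_mem_iff_left Y hn).1 hdescend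

theorem deligneStep_le (hY : parabolic E b ⊆ Y) : deligneStep E b ≤ Y := fun _ hm =>
  mem_of_embed_mem_approximable hY (ElementaryModel.regularLattice_subset
    (fun _ => theta_mem_approximable) (fun _ => mem_approximable_of_mem_parabolicLattice hY) hm)

variable (E)

theorem span_parabolic (b : ℝ) :
    Submodule.span (LogOps D) (parabolic E b) = deligneStep E b := by
  refine le_antisymm (Submodule.span_le.2 fun m hm => ?_) (deligneStep_le Submodule.subset_span)
  exact E.parabolicLattice_le_regularLattice _ ((mem_parabolic E).1 hm)

/-- The component in `R_φ` of the elements of `M`. -/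
def component (φ : E.Φ) : M →ₗ[ℂ] E.R φ :=
  (E.component φ).restrictScalars ℂ ∘ₗ embed M q

theorem component_theta {φ : E.Φ} (hφ : (φ : Polynomial ℂ) = 0) (m : M) :
    (E.conn φ).θ (component E φ m) = (q : ℂ) • component E φ (D.θ m) := by
  rw [← map_smul]
  change (E.conn φ).θ (E.iso (embed M q m) φ) = E.iso (embed M q ((q : ℂ) • D.θ m)) φ
  rw [← E.iso_theta_of_eq_zero hφ, embed_theta, LinearMap.map_smul]

theorem mem_deligneStep_iff_component {φ : E.Φ} (hφ : (φ : Polynomial ℂ) = 0) {b : ℝ} {m : M} :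
    m ∈ deligneStep E b ↔ component E φ m ∈ deligneLattice (E.conn φ) (q * b) := by
  refine ⟨fun h => h φ hφ, fun h ψ hψ => ?_⟩
  obtain rfl : ψ = φ := Subtype.ext (hψ.trans hφ.symm)
  exact h

theorem deligneStep_eq_top (h : ∀ φ : E.Φ, (φ : Polynomial ℂ) ≠ 0) (b : ℝ) :
    deligneStep E b = ⊤ :=
  eq_top_iff.2 fun _ _ φ hφ => absurd hφ (h φ)

theorem finiteDimensional_gr_deligneStep (b : ℝ) :
    FiniteDimensional ℂ (Gr (deligneStep E) b) := by
  by_cases! h : ∃ φ : E.Φ, (φ : Polynomial ℂ) = 0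
  · obtain ⟨φ, hφ⟩ := h
    have := finiteDimensional_latticeSpace_quotient
      (isLogLattice_deligneLattice (E.regular φ) (q * b)).fg
    refine finiteDimensional_gr_of_map (component E φ)
      (B := latticeSpace (deligneLattice (E.conn φ) (q * b)))
      (A := latticeSpace (shift (deligneLattice (E.conn φ) (q * b)) 1))
      (fun m hm => (mem_deligneStep_iff_component E hφ).1 hm) fun m _ hm => ?_
    rw [mem_latticeSpace, shift_deligneLattice (E.regular φ)] at hm
    have hq : (0 : ℝ) < q := Nat.cast_pos.2 (NeZero.pos q)
    refine (mem_filtGt (deligneStep_antitone E)).2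
      ⟨b + 1 / q, lt_add_of_pos_right b (one_div_pos.2 hq), ?_⟩
    rw [mem_deligneStep_iff_component E hφ, mul_add, mul_one_div_cancel hq.ne']
    exact_mod_cast hm
  · have htop : (filtGt (deligneStep E) b).submoduleOf (deligneStep E b) = ⊤ :=
      eq_top_iff.2 fun m _ => (mem_filtGt (deligneStep_antitone E)).2
        ⟨b + 1, lt_add_one b, deligneStep_eq_top E h (b + 1) ▸ Submodule.mem_top⟩
    have := Submodule.Quotient.subsingleton_iff.2 htop
    infer_instance

theorem exists_gt_mem_deligneStep_of_re_ne {b c : ℝ} (hbc : b < c) {m : M} {β : ℂ}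
    (hm : m ∈ deligneStep E b) (hc : D.θ m - β • m ∈ deligneStep E c) (hne : β.re ≠ b) :
    ∃ d, b < d ∧ m ∈ deligneStep E d := by
  have hq : (0 : ℝ) < q := Nat.cast_pos.2 (NeZero.pos q)
  by_cases! h : ∃ φ : E.Φ, (φ : Polynomial ℂ) = 0
  · obtain ⟨φ, hφ⟩ := h
    simp only [mem_deligneStep_iff_component E hφ] at hm hc ⊢
    have hβ := complex_smul_mem _ (q : ℂ) hc
    rw [map_sub, map_smul, smul_sub, ← component_theta E hφ, smul_smul] at hβ
    have hre : ((q : ℂ) * β).re ≠ q * b := by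
      rw [← Complex.ofReal_natCast, Complex.re_ofReal_mul]
      exact fun h => hne (mul_left_cancel₀ hq.ne' h)
    obtain ⟨d, hd, hmd⟩ := exists_gt_mem_deligneLattice_of_re_ne (E.regular φ)
      (mul_lt_mul_of_pos_left hbc hq) hm hβ hre
    exact ⟨d / q, by rwa [lt_div_iff₀ hq, mul_comm], by rwa [mul_div_cancel₀ _ hq.ne']⟩
  · exact ⟨b + 1, lt_add_one b, deligneStep_eq_top E h _ ▸ Submodule.mem_top⟩

theorem iSup_deligneStep : ⨆ b, deligneStep E b = ⊤ := by
  refine eq_top_iff.2 fun m _ => ?_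
  obtain ⟨c, hc⟩ := E.exists_mem_parabolicLattice (embed M q m)
  refine Submodule.mem_iSup_of_mem (c / q) ?_
  rw [mem_deligneStep, mul_div_cancel₀ _ (NeZero.ne (q : ℝ))]
  exact E.parabolicLattice_le_regularLattice c hc

theorem iInf_deligneStep (b : ℝ) : ⨅ c : Set.Iio b, deligneStep E c = deligneStep E b := by
  refine le_antisymm (fun m hm => ?_) (le_iInf fun c => deligneStep_antitone E (le_of_lt c.2))
  rw [Submodule.mem_iInf] at hm
  have hq : (0 : ℝ) < q := Nat.cast_pos.2 (NeZero.pos q)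
  refine E.mem_regularLattice_of_forall_lt fun c hc => ?_
  have hmem := hm ⟨c / q, (div_lt_iff₀' hq).2 hc⟩
  rwa [mem_deligneStep, mul_div_cancel₀ _ hq.ne'] at hmem

theorem coordX_smul_mem_deligneStep (b : ℝ) (m : M) :
    coordX • m ∈ deligneStep E (b + 1) ↔ m ∈ deligneStep E b := by
  have hembed : embed M q (coordX • m) = yPow q • embed M q m := by
    simpa using embed_coordX_pow_smul (q := q) 1 m
  have hmem := E.yPow_smul_mem_regularLattice q (q * b) (embed M q m)
  rw [mem_deligneStep, mem_deligneStep, hembed, mul_add, mul_one]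
  exact hmem

theorem re_eq_of_hasEigenvalue_gr_deligneStep (b : ℝ) (β : ℂ)
    (hβ : Module.End.HasEigenvalue
      (Algebra.lsmul ℂ ℂ (Gr (deligneStep E) b) (LogOps.xdx D)) β) : β.re = b := by
  obtain ⟨v, hv⟩ := hβ.exists_hasEigenvector
  obtain ⟨m, rfl⟩ := Submodule.Quotient.mk_surjective _ v
  have hne : (m : M) ∉ filtGt (deligneStep E) b := fun h =>
    hv.2 ((Submodule.Quotient.mk_eq_zero
      ((filtGt (deligneStep E) b).submoduleOf (deligneStep E b))).2 h)
  have heigen : D.θ m - β • (m : M) ∈ filtGt (deligneStep E) b :=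
    (Submodule.Quotient.eq ((filtGt (deligneStep E) b).submoduleOf (deligneStep E b))).1
      (Module.End.mem_eigenspace_iff.1 hv.1)
  simp only [mem_filtGt (deligneStep_antitone E)] at hne heigen
  obtain ⟨c, hbc, hc⟩ := heigen
  by_contra hre
  exact hne (exists_gt_mem_deligneStep_of_re_ne E hbc m.2 hc hre)

theorem isDeligneFiltration_deligneStep [FiniteDimensional ConvLaurent M] :
    IsDeligneFiltration D (deligneStep E) where
  antitone := deligneStep_antitone E
  exhaustive := iSup_deligneStep E
  left_continuous := iInf_deligneStep E
  fg b := span_parabolic E b ▸ fg_span_parabolic E b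
  mul_x := coordX_smul_mem_deligneStep E
  finite_gr := finiteDimensional_gr_deligneStep E
  eigenvalue_re := re_eq_of_hasEigenvalue_gr_deligneStep E

end Existence

end MeroConn

end

open MeroConn

theorem mainTheorem4 {M : Type*} [AddCommGroup M] [Module ℂ M] [Module ConvLaurent M]
    [IsScalarTower ℂ ConvLaurent M] [FiniteDimensional ConvLaurent M]
    (D : Connection eulerConv M) (q : ℕ) [NeZero q]
    (E : ElementaryModel (D.ramPullback q).formalization) :
    (∃! V : ℝ → Submodule (LogOps D) M, IsDeligneFiltration D V) ∧
    ∀ V : ℝ → Submodule (LogOps D) M, IsDeligneFiltration D V →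
      ∀ b : ℝ, Submodule.span (LogOps D) (parabolic E b) = V b := by
  have hE := isDeligneFiltration_deligneStep E
  refine ⟨⟨_, hE, fun V hV => hV.unique hE⟩, fun V hV b => ?_⟩
  rw [hV.unique hE, span_parabolic]
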